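/- **Setting.** Let $\alpha\in(0,2)$ and $\theta>0$, and let $\mathcal T$ be the tempered stable subordinator with parameters $(\alpha,\theta)$, i.e. a positive random variable with characteristic function $$E[e^{iu\mathcal T}]=\exp\Big(-\tfrac{2\theta^{1-\alpha/2}}{\alpha}\big((\theta-iu)^{\alpha/2}-\theta^{\alpha/2}\big)\Big),\qquad u\in\mathbb R .$$ Put $B=\sqrt{2\theta/(2-\alpha)}$. For $\beta\in\mathbb R^N$ with $|\beta_n|<B$ for all $n$ and a correlation matrix $C$ (positive semidefinite, unit diagonal), $\mathrm{stdNTS}_N(\alpha,\theta,\beta,C)$ is the law of $\beta(\mathcal T-1)+\mathrm{diag}(\gamma)\,\varepsilon\sqrt{\mathcal T}$, where $\gamma_n=\sqrt{1-\beta_n^2\frac{2-\alpha}{2\theta}}$ and $\varepsilon\sim N(0,C)$ is independent of $\mathcal T$. For a scalar $\beta$ with $|\beta|<B$ let $F^{-1}(\cdot,\alpha,\theta,\beta)$ and $\phi(z,\alpha,\theta,\beta)=E[e^{iz\Xi}]$ be the inverse distribution function and the characteristic function (at complex $z$, wherever the expectation is finite) of $\Xi\sim\mathrm{stdNTS}_1(\alpha,\theta,\beta,1)$.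 For a real random variable $Y$ and $\eta\in(0,1)$ let $\mathrm{VaR}_\eta(Y)=-\inf\{x: P(Y\le x)\ge\eta\}$ and $\mathrm{CVaR}_\eta(Y)=\frac1\eta\int_0^\eta \mathrm{VaR}_t(Y)\,dt$, and write $\mathrm{CVaR}_{\mathrm{stdNTS}}(\eta,\alpha,\theta,\beta)=\mathrm{CVaR}_\eta(\Xi)$. Let $R=\mu+\mathrm{diag}(\sigma)X$ with $\mu\in\mathbb R^N$, $\sigma\in[0,\infty)^N$ and $X\sim\mathrm{stdNTS}_N(\alpha,\theta,\beta,C)$. For weights $w$ put $$R_P(w)=w^{\mathsf T}R,\qquad \bar\sigma(w)=\sqrt{\textstyle\sum_{k,l}w_kw_l\,\mathrm{cov}(R_k,R_l)},\qquad \bar\beta(w)=\frac{\sum_k w_k\sigma_k\beta_k}{\bar\sigma(w)} .$$ **Proposition.** Let $\eta\in(0,1)$ and let $w\in[0,1]^N$ be such that $\bar\sigma(w)>0$ and $|\bar\beta(w)|<B$. (a) The integrals defining $\mathrm{CVaR}_\eta(R_P(v))$, $v\in\mathbb R^N$, converge, and for every $n\in\{1,\dots,N\}$ the following partial derivatives at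 $w$ (of functions of the weight vector in $\mathbb R^N$) exist and satisfy $$\frac{\partial\bar\sigma(w)}{\partial w_n}=\frac{\sum_{k}w_k\,\mathrm{cov}(R_n,R_k)}{\bar\sigma(w)},$$ $$\frac{\partial \mathrm{VaR}_\eta(R_P(w))}{\partial w_n}=-\mu_n-F^{-1}(\eta,\alpha,\theta,\bar\beta(w))\frac{\partial\bar\sigma(w)}{\partial w_n}-\Big(\sigma_n\beta_n-\bar\beta(w)\frac{\partial\bar\sigma(w)}{\partial w_n}\Big)\frac{\partial F^{-1}(\eta,\alpha,\theta,\beta)}{\partial\beta}\Big|_{\beta=\bar\beta(w)},$$ $$\frac{\partial \mathrm{CVaR}_\eta(R_P(w))}{\partial w_n}=-\mu_n+\mathrm{CVaR}_{\mathrm{stdNTS}}(\eta,\alpha,\theta,\bar\beta(w))\frac{\partial\bar\sigma(w)}{\partial w_n}+\Big(\sigma_n\beta_n-\bar\beta(w)\frac{\partial\bar\sigma(w)}{\partial w_n}\Big)\frac{\partial \mathrm{CVaR}_{\mathrm{stdNTS}}(\eta,\alpha,\theta,\beta)}{\partial\beta}\Big|_{\beta=\bar\beta(w)} .$$ (b)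 For every scalar $\beta$ with $|\beta|<B$, the $\beta$-derivatives of $F^{-1}(\eta,\alpha,\theta,\beta)$ and $\mathrm{CVaR}_{\mathrm{stdNTS}}(\eta,\alpha,\theta,\beta)$ exist (and the integral defining the latter converges); there is $\delta>0$ such that $\phi(-u+i\delta,\alpha,\theta,\beta)$ is finite for all $u\in\mathbb R$; and for every such $\delta$ $$\frac{\partial \mathrm{CVaR}_{\mathrm{stdNTS}}(\eta,\alpha,\theta,\beta)}{\partial\beta}=-\frac{\partial F^{-1}(\eta,\alpha,\theta,\beta)}{\partial\beta}-\frac1{\pi\eta}\mathrm{Re}\int_0^\infty e^{(iu+\delta)F^{-1}(\eta,\alpha,\theta,\beta)}\frac{\phi(-u+i\delta,\alpha,\theta,\beta)}{(-u+i\delta)^2}\Big((\delta+iu)\frac{\partial F^{-1}(\eta,\alpha,\theta,\beta)}{\partial\beta}+\psi(-u+i\delta,\alpha,\theta,\beta)\Big)du$$ with an absolutely convergent integral, where $$\psi(z,\alpha,\theta,\beta)=-zi+\Big(1-\frac{iz\beta}{\theta}+\Big(1-\frac{\beta^2(2-\alpha)}{2\theta}\Big)\frac{z^2}{2\theta}\Big)^{\frac\alpha2-1}\Big(zi+\frac{\beta(2-\alpha)}{2\theta}z^2\Big).$$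 Moreover $\psi=\partial_\beta\log\phi$, in the sense that $\partial_\beta\phi(z,\alpha,\theta,\beta)=\phi(z,\alpha,\theta,\beta)\,\psi(z,\alpha,\theta,\beta)$ at $z=-u+i\delta$, $u\in\mathbb R$, whenever $\delta>0$ is such that $\phi(\cdot+i\delta,\alpha,\theta,\beta')$ is finite on $\mathbb R$ for all $\beta'$ near $\beta$. -/

import Mathlib

open MeasureTheory ProbabilityTheory Set Filter Topology

namespace NTS

noncomputable section

/-! ### Risk measures of a probability law on the real line (returns, significance level `η`) -/

/-- The (generalized) inverse of the cumulative distribution function of `m`. -/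
def quantile (m : Measure ℝ) (η : ℝ) : ℝ := sInf {x : ℝ | η ≤ cdf m x}

/-- Value-at-Risk at significance level `η` of a return with law `m`. -/
def VaR (m : Measure ℝ) (η : ℝ) : ℝ := -quantile m η

/-- Conditional Value-at-Risk at significance level `η` of a return with law `m`:
the average of the Values-at-Risk at the levels between `0` and `η`. -/
def CVaR (m : Measure ℝ) (η : ℝ) : ℝ := (1 / η) * ∫ t in (0 : ℝ)..η, VaR m t

/-- The characteristic function of `m` at a complex argument `z`, i.e. `∫ exp (i z x) dm(x)`. -/
def chF (m : Measure ℝ) (z : ℂ) : ℂ := complexMGF id m (Complex.I * z)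

/-- The characteristic function of `m` is finite on the whole line `{-u + i δ | u ∈ ℝ}`. -/
def FiniteChFOnLine (m : Measure ℝ) (δ : ℝ) : Prop :=
  ∀ u : ℝ, Integrable (fun x : ℝ => Complex.exp (Complex.I * (-u + Complex.I * δ) * x)) m

/-! ### The tempered stable subordinator -/

/-- `m` is the law of the tempered stable subordinator with parameters `(α, θ)`: the law of a
positive random variable with the prescribed characteristic function. -/
structure IsTemperedStable (α θ : ℝ) (m : Measure ℝ) : Prop where
  isProbabilityMeasure : IsProbabilityMeasure m
  pos : m (Iic 0) = 0
  charFun_eq : ∀ u : ℝ, charFun m u =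
    Complex.exp (-(2 * (θ : ℂ) ^ (1 - (α : ℂ) / 2) / α) *
      (((θ : ℂ) - Complex.I * u) ^ ((α : ℂ) / 2) - (θ : ℂ) ^ ((α : ℂ) / 2)))

theorem IsTemperedStable.unique {α θ : ℝ} {m m' : Measure ℝ}
    (h : IsTemperedStable α θ m) (h' : IsTemperedStable α θ m') : m = m' := by
  have := h.isProbabilityMeasure
  have := h'.isProbabilityMeasure
  exact Measure.ext_of_charFun (funext fun u => by rw [h.charFun_eq, h'.charFun_eq])

open Classical in
/-- The law of the tempered stable subordinator with parameters `(α, θ)`. -/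
def temperedStableLaw (α θ : ℝ) : Measure ℝ :=
  if h : ∃ m, IsTemperedStable α θ m then h.choose else 0

theorem temperedStableLaw_eq {α θ : ℝ} {m : Measure ℝ} (h : IsTemperedStable α θ m) :
    temperedStableLaw α θ = m := by
  have hex : ∃ m, IsTemperedStable α θ m := ⟨m, h⟩
  rw [temperedStableLaw, dif_pos hex]
  exact hex.choose_spec.unique h

/-! ### The standard normal tempered stable distributions -/

/-- The admissible bound for the components of `β`. -/
def betaBound (α θ : ℝ) : ℝ := √(2 * θ / (2 - α))

/-- The coefficient `γ` of the Gaussian part which makes the variance equal to one. -/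
def gammaCoef (α θ β : ℝ) : ℝ := √(1 - β ^ 2 * ((2 - α) / (2 * θ)))

/-- The law `stdNTS_N(α, θ, β, C)`: the law of `β (T - 1) + diag(γ) ε √T` with `T` the tempered
stable subordinator and `ε` a centered Gaussian vector with covariance matrix `C`, independent
of `T`. -/
def stdNTSLaw {N : ℕ} (α θ : ℝ) (β : Fin N → ℝ) (C : Matrix (Fin N) (Fin N) ℝ) :
    Measure (Fin N → ℝ) :=
  ((temperedStableLaw α θ).prod (multivariateGaussian 0 C)).map
    (fun p n => β n * (p.1 - 1) + gammaCoef α θ (β n) * p.2 n * √p.1)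

/-- The law `stdNTS_1(α, θ, β, 1)` on the real line. -/
def stdNTSLaw1 (α θ β : ℝ) : Measure ℝ :=
  ((temperedStableLaw α θ).prod (gaussianReal 0 1)).map
    (fun p => β * (p.1 - 1) + gammaCoef α θ β * p.2 * √p.1)

/-- Inverse distribution function of `stdNTS_1(α, θ, β, 1)`. -/
def stdNTSQuantile (η α θ β : ℝ) : ℝ := quantile (stdNTSLaw1 α θ β) η

/-- Conditional Value-at-Risk of `stdNTS_1(α, θ, β, 1)`. -/
def stdNTSCVaR (η α θ β : ℝ) : ℝ := CVaR (stdNTSLaw1 α θ β) η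

/-- Characteristic function of `stdNTS_1(α, θ, β, 1)` (at complex arguments). -/
def stdNTSChF (z : ℂ) (α θ β : ℝ) : ℂ := chF (stdNTSLaw1 α θ β) z

/-- The function `ψ(z, α, θ, β)`. -/
def psi (z : ℂ) (α θ β : ℝ) : ℂ :=
  -z * Complex.I
    + (1 - Complex.I * z * β / θ
        + (1 - (β : ℂ) ^ 2 * (2 - α) / (2 * θ)) * (z ^ 2 / (2 * θ))) ^ ((α : ℂ) / 2 - 1)
      * (z * Complex.I + β * (2 - α) / (2 * θ) * z ^ 2)

/-- The integrand in the formula for the `β`-derivative of `stdNTSCVaR`. -/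
def cvarIntegrand (η α θ β δ u : ℝ) : ℂ :=
  Complex.exp ((Complex.I * u + δ) * stdNTSQuantile η α θ β)
    * (stdNTSChF (-u + Complex.I * δ) α θ β / (-u + Complex.I * δ) ^ 2)
    * ((δ + Complex.I * u) * (deriv (fun b => stdNTSQuantile η α θ b) β : ℝ)
        + psi (-u + Complex.I * δ) α θ β)

/-! ### Portfolios -/

section Portfolio

variable {Ω : Type*} [MeasurableSpace Ω] {N : ℕ}

/-- The portfolio return `R_P(w) = wᵀ R`. -/
def portfolioReturn (R : Fin N → Ω → ℝ) (w : Fin N → ℝ) (ω : Ω) : ℝ := ∑ k, w k * R k ω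

/-- `σ̄(w)`, the square root of `wᵀ Σ_R w` with `Σ_R` the covariance matrix of `R`. -/
def sigmaBar (P : Measure Ω) (R : Fin N → Ω → ℝ) (w : Fin N → ℝ) : ℝ :=
  √(∑ k, ∑ l, w k * w l * cov[R k, R l; P])

/-- `β̄(w) = wᵀ diag(σ) β / σ̄(w)`. -/
def betaBar (P : Measure Ω) (R : Fin N → Ω → ℝ) (σ β w : Fin N → ℝ) : ℝ :=
  (∑ k, w k * σ k * β k) / sigmaBar P R w

end Portfolio

end

end NTS

/-!
The statement concerns the laws of `Ξ = β (T - 1) + γ ε √T`. Everything rests on three facts.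

*The exponential moments of `T`.* Only the Fourier transform of `T` is given. The Laplace transform
and the closed formula `tsMGF` agree on the imaginary axis, hence on the left half-plane by the
Phragmén-Lindelöf principle (`IsTemperedStable.complexMGF_eq_of_nonpos`). By Landau's theorem on
Laplace transforms of positive laws (`mem_integrableExpSet_of_differentiableOn`) the formula
persists up to `re w < θ`, and it fails beyond `θ` because the derivative of the formula blows up
there (`IsTemperedStable.integrableExpSet_subset`). Integrating out the Gaussian variable
gives `E[exp (-s Ξ)]` in closed form (`ntsMGF`) and bounds the set of `δ` for which it is finite on
the line `re s = δ`: `ntsBaseReal α θ β δ > 0` is sufficient and `ntsBaseReal α θ β δ ≥ 0` is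
necessary.

*The Fourier representation.* Inserting `π max y 0 = re ∫ exp ((δ + i u) y) / (δ + i u) ^ 2 du`,
with `u` in `(0, ∞)`, into `E[max (a - Ξ) 0]` gives the expected shortfall, and differentiation in
`a` gives the distribution function. The moment generating function decays like `exp (-c u ^ α)`,
so these integrals are jointly differentiable in `a` and `β`
(`hasFDerivAt_integral_fourierTerm`); the density is positive because `Ξ` is a Gaussian mixture
(`exists_mul_le_mixLaw_Ioc`). A monotonicity argument then yields the differentiability of the
quantile (`hasDerivAt_quantile`), and since `CVaR = -q + E[max (q - Ξ) 0] / η` at the quantile `q`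
(`CVaR_eq`), the chain rule gives the derivative of the Conditional Value-at-Risk. If `δ` is on the
boundary of the region of convergence, the base of the fractional power vanishes at `u = 0`, but
only to first order (`mul_le_norm_ntsBase`), and the formula is the limit of the formulas from the
interior (`tendsto_integral_fourierTermDeriv`).

*Portfolios.* Given `T`, a portfolio return is Gaussian, and a comparison of variances shows that
it has the law of `∑ k, v k * μ k + σ̄ Ξ` with `Ξ` standard NTS with parameter `β̄`
(`map_portfolioReturn`). The marginal contributions follow from the chain rule.
-/

namespace NTS

/-! ### Quantiles and the Conditional Value-at-Risk -/

section Quantile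

variable {m : Measure ℝ} {η : ℝ}

/-- The Galois connection between the distribution function and its generalized inverse. -/
theorem quantile_le_iff (hη : η ∈ Ioo (0 : ℝ) 1) {x : ℝ} :
    quantile m η ≤ x ↔ η ≤ cdf m x := by
  have hbdd : BddBelow {x : ℝ | η ≤ cdf m x} := by
    obtain ⟨a, ha⟩ := ((tendsto_cdf_atBot m).eventually_lt_const hη.1).exists
    exact ⟨a, fun y hy => not_lt.1 fun h => (hy.trans (monotone_cdf m h.le)).not_gt ha⟩
  have hne : {x : ℝ | η ≤ cdf m x}.Nonempty := by
    obtain ⟨a, ha⟩ := ((tendsto_cdf_atTop m).eventually_const_lt hη.2).exists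
    exact ⟨a, ha.le⟩
  refine ⟨fun h => ?_, fun h => csInf_le hbdd h⟩
  have hlim : Tendsto (cdf m) (𝓝[>] x) (𝓝 (cdf m x)) :=
    ((cdf m).right_continuous x).tendsto.mono_left (nhdsWithin_mono _ Ioi_subset_Ici_self)
  refine ge_of_tendsto hlim ?_
  filter_upwards [self_mem_nhdsWithin] with y hy
  obtain ⟨z, hz, hzy⟩ := exists_lt_of_csInf_lt hne (lt_of_le_of_lt h hy)
  exact le_trans hz (monotone_cdf m hzy.le)

theorem monotoneOn_quantile : MonotoneOn (quantile m) (Ioo 0 1) := fun _ hs _ ht hst =>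
  (quantile_le_iff hs).2 (hst.trans ((quantile_le_iff ht).1 le_rfl))

theorem aemeasurable_quantile : AEMeasurable (quantile m) (volume.restrict (Ioo 0 1)) :=
  aemeasurable_restrict_of_monotoneOn measurableSet_Ioo monotoneOn_quantile

theorem cdf_quantile (hη : η ∈ Ioo (0 : ℝ) 1) (hc : ContinuousAt (cdf m) (quantile m η)) :
    cdf m (quantile m η) = η := by
  refine le_antisymm ?_ ((quantile_le_iff hη).1 le_rfl)
  refine le_of_tendsto (hc.tendsto.mono_left (nhdsWithin_le_nhds (s := Iio (quantile m η)))) ?_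
  filter_upwards [self_mem_nhdsWithin] with y hy
  exact le_of_not_ge fun h => not_le.2 hy ((quantile_le_iff hη).2 h)

variable [IsProbabilityMeasure m]

/-- The quantile function transports Lebesgue measure on `(0, 1)` to the given law. -/
theorem map_quantile : (volume.restrict (Ioo (0 : ℝ) 1)).map (quantile m) = m := by
  have : IsProbabilityMeasure (volume.restrict (Ioo (0 : ℝ) 1)) := ⟨by simp⟩
  have := Measure.isProbabilityMeasure_map (aemeasurable_quantile (m := m))
  refine Measure.ext_of_Iic _ _ fun x => ?_
  rw [Measure.map_apply_of_aemeasurable aemeasurable_quantile measurableSet_Iic,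
    Measure.restrict_apply₀' measurableSet_Ioo.nullMeasurableSet, ← ofReal_cdf m x]
  have h : quantile m ⁻¹' Iic x ∩ Ioo 0 1 = Iic (cdf m x) ∩ Ioo 0 1 := by
    ext t
    simp only [mem_inter_iff, mem_preimage, mem_Iic]
    exact and_congr_left fun ht => quantile_le_iff ht
  rw [h]
  have h0 := cdf_nonneg m x
  have h1 := cdf_le_one m x
  refine le_antisymm ?_ ?_
  · refine (measure_mono (t := Ioc 0 (cdf m x)) fun t ht => ⟨ht.2.1, ht.1⟩).trans ?_
    simp
  · refine le_trans ?_ (measure_mono (s := Ioo 0 (cdf m x)) fun t ht =>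
      ⟨ht.2.le, ht.1, ht.2.trans_le h1⟩)
    simp

theorem integrableOn_quantile (hm : Integrable id m) :
    IntegrableOn (quantile m) (Ioo 0 1) := by
  rw [← map_quantile (m := m)] at hm
  exact (integrable_map_measure aestronglyMeasurable_id aemeasurable_quantile).1 hm

theorem intervalIntegrable_quantile (hm : Integrable id m) (hη : η ∈ Ioo (0 : ℝ) 1) :
    IntervalIntegrable (quantile m) volume 0 η := by
  rw [intervalIntegrable_iff_integrableOn_Ioc_of_le hη.1.le]
  exact (integrableOn_quantile hm).mono_set fun t ht => ⟨ht.1, ht.2.trans_lt hη.2⟩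

theorem intervalIntegrable_VaR (hm : Integrable id m) (hη : η ∈ Ioo (0 : ℝ) 1) :
    IntervalIntegrable (fun t => VaR m t) volume 0 η :=
  (intervalIntegrable_quantile hm hη).neg

theorem integral_quantile (hm : Integrable id m) (hη : η ∈ Ioo (0 : ℝ) 1) :
    ∫ t in (0 : ℝ)..η, quantile m t
      = η * quantile m η - ∫ x, max (quantile m η - x) 0 ∂m := by
  set q := quantile m η with hq
  have hint := intervalIntegrable_quantile hm hη
  have hcont : Continuous fun x : ℝ => max (q - x) 0 := by fun_prop
  have h1 : ∫ x, max (q - x) 0 ∂m = ∫ t in Ioo (0 : ℝ) 1, max (q - quantile m t) 0 := by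
    conv_lhs => rw [← map_quantile (m := m)]
    rw [integral_map aemeasurable_quantile hcont.aestronglyMeasurable]
  have h2 : ∫ t in Ioo (0 : ℝ) 1, max (q - quantile m t) 0
      = ∫ t in Ioc (0 : ℝ) η, (q - quantile m t) := by
    rw [← integral_indicator measurableSet_Ioo, ← integral_indicator measurableSet_Ioc]
    congr 1
    ext t
    simp only [indicator_apply, mem_Ioo, mem_Ioc]
    by_cases ht : 0 < t ∧ t < 1
    · rw [if_pos ht]
      rcases le_or_gt t η with h | h
      · rw [if_pos ⟨ht.1, h⟩]
        exact max_eq_left (sub_nonneg.2 (monotoneOn_quantile ht hη h))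
      · rw [if_neg fun h' => h'.2.not_gt h]
        exact max_eq_right (sub_nonpos.2 (monotoneOn_quantile hη ht h.le))
    · rw [if_neg ht, if_neg fun h' => ht ⟨h'.1, h'.2.trans_lt hη.2⟩]
  rw [h1, h2, ← intervalIntegral.integral_of_le hη.1.le,
    intervalIntegral.integral_sub intervalIntegrable_const hint]
  simp

/-- The Conditional Value-at-Risk as an expected shortfall below the quantile. -/
theorem CVaR_eq (hm : Integrable id m) (hη : η ∈ Ioo (0 : ℝ) 1) :
    CVaR m η = -quantile m η + 1 / η * ∫ x, max (quantile m η - x) 0 ∂m := by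
  have h0 := hη.1.ne'
  simp only [CVaR, VaR, intervalIntegral.integral_neg]
  rw [integral_quantile hm hη]
  field_simp
  ring

theorem quantile_map_affine {a c : ℝ} (hc : 0 < c) (hη : η ∈ Ioo (0 : ℝ) 1) :
    quantile (m.map fun x => a + c * x) η = a + c * quantile m η := by
  have hmeas : Measurable fun x : ℝ => a + c * x := by fun_prop
  have := Measure.isProbabilityMeasure_map (μ := m) hmeas.aemeasurable
  refine eq_of_forall_ge_iff fun x => ?_
  have h : cdf (m.map fun x => a + c * x) x = cdf m ((x - a) / c) := by
    rw [cdf_eq_real, cdf_eq_real, map_measureReal_apply hmeas measurableSet_Iic]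
    congr 1
    ext y
    simp only [mem_preimage, mem_Iic, le_div_iff₀ hc]
    constructor <;> intro h <;> linarith
  rw [quantile_le_iff hη, h, ← quantile_le_iff hη, le_div_iff₀ hc]
  constructor <;> intro h <;> linarith

theorem CVaR_map_affine (hm : Integrable id m) {a c : ℝ} (hc : 0 < c)
    (hη : η ∈ Ioo (0 : ℝ) 1) :
    CVaR (m.map fun x => a + c * x) η = -a + c * CVaR m η := by
  have h : ∫ t in (0 : ℝ)..η, VaR (m.map fun x => a + c * x) t
      = ∫ t in (0 : ℝ)..η, (-a + c * VaR m t) := by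
    refine intervalIntegral.integral_congr_ae (Eventually.of_forall fun t ht => ?_)
    rw [uIoc_of_le hη.1.le] at ht
    simp only [VaR, quantile_map_affine hc ⟨ht.1, ht.2.trans_lt hη.2⟩]
    ring
  have h0 := hη.1.ne'
  rw [CVaR, h, intervalIntegral.integral_add intervalIntegrable_const
    ((intervalIntegrable_VaR hm hη).const_mul c), intervalIntegral.integral_const,
    intervalIntegral.integral_const_mul, CVaR]
  simp only [smul_eq_mul]
  field_simp
  ring

end Quantile

/-- If the distribution functions of a family of laws are jointly differentiable at a point of
the level set `{cdf = η}`, with positive density there, then the quantile is differentiable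
in the parameter. Monotonicity of the distribution functions replaces the continuity of the
quantile that the implicit function theorem would ask for. -/
theorem hasDerivAt_quantile {ν : ℝ → Measure ℝ} {η b₀ fx fb : ℝ}
    (hη : η ∈ Ioo (0 : ℝ) 1)
    {L : ℝ × ℝ →L[ℝ] ℝ} (hLx : L (1, 0) = fx) (hLb : L (0, 1) = fb) (hfx : 0 < fx)
    (hF : HasFDerivAt (fun p : ℝ × ℝ => cdf (ν p.2) p.1) L (quantile (ν b₀) η, b₀))
    (hval : cdf (ν b₀) (quantile (ν b₀) η) = η) :
    HasDerivAt (fun b => quantile (ν b) η) (-fb / fx) b₀ := by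
  set q := quantile (ν b₀) η with hq
  have hL : ∀ x y, L (x, y) = x * fx + y * fb := fun x y => by
    have : ((x, y) : ℝ × ℝ) = x • (1, 0) + y • (0, 1) := by simp
    rw [this, map_add, map_smul, map_smul, hLx, hLb, smul_eq_mul, smul_eq_mul]
  -- the distribution function along a line through the base point
  have key : ∀ k : ℝ, HasDerivAt (fun b => cdf (ν b) (q + k * (b - b₀))) (k * fx + fb) b₀ := by
    intro k
    have hline : HasDerivAt (fun b : ℝ => (q + k * (b - b₀), b)) (k, 1) b₀ := by
      refine HasDerivAt.prodMk ?_ (hasDerivAt_id b₀)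
      simpa using (((hasDerivAt_id b₀).sub_const b₀).const_mul k).const_add q
    have h0 : (q, b₀) = (q + k * (b₀ - b₀), b₀) := by simp
    rw [h0] at hF
    have := HasFDerivAt.comp_hasDerivAt (f := fun b => (q + k * (b - b₀), b)) b₀ hF hline
    rw [hL, one_mul] at this
    exact this
  rw [hasDerivAt_iff_isLittleO, Asymptotics.isLittleO_iff]
  intro ε hε
  have hup := key (-fb / fx + ε)
  have hdn := key (-fb / fx - ε)
  have e1 : (-fb / fx + ε) * fx + fb = ε * fx := by field_simp; ring
  have e2 : (-fb / fx - ε) * fx + fb = -(ε * fx) := by field_simp; ring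
  rw [e1] at hup
  rw [e2] at hdn
  have hpos : 0 < ε * fx := mul_pos hε hfx
  have hup' := (hasDerivAt_iff_isLittleO.1 hup).def (half_pos hpos)
  have hdn' := (hasDerivAt_iff_isLittleO.1 hdn).def (half_pos hpos)
  filter_upwards [hup', hdn'] with b h1 h2
  simp only [sub_self, mul_zero, add_zero, hval, smul_eq_mul, Real.norm_eq_abs] at h1 h2 ⊢
  rcases lt_trichotomy b b₀ with hb | hb | hb
  · rw [abs_of_neg (sub_neg.2 hb)] at h1 h2 ⊢
    rw [abs_le] at h1 h2
    have hu : ¬ (η ≤ cdf (ν b) (q + (-fb / fx + ε) * (b - b₀))) := by nlinarith [h1.2]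
    have hd : η ≤ cdf (ν b) (q + (-fb / fx - ε) * (b - b₀)) := by nlinarith [h2.1]
    rw [← quantile_le_iff hη, not_le] at hu
    rw [← quantile_le_iff hη] at hd
    rw [abs_le]
    constructor <;> linarith
  · simp [hb, ← hq]
  · rw [abs_of_pos (sub_pos.2 hb)] at h1 h2 ⊢
    rw [abs_le] at h1 h2
    have hu : η ≤ cdf (ν b) (q + (-fb / fx + ε) * (b - b₀)) := by nlinarith [h1.1]
    have hd : ¬ (η ≤ cdf (ν b) (q + (-fb / fx - ε) * (b - b₀))) := by nlinarith [h2.2]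
    rw [← quantile_le_iff hη, not_le] at hd
    rw [← quantile_le_iff hη] at hu
    rw [abs_le]
    constructor <;> linarith

/-! ### Laplace transforms of positive laws -/

section PositiveLaw

variable {m : Measure ℝ}

/-- Landau's theorem on the abscissa of convergence: the Laplace transform of a positive law
converges on every interval to which its analytic continuation reaches. The Taylor coefficients
at `c` are nonnegative, so the convergence of the Taylor series gives the convergence of the
integral. -/
theorem mem_integrableExpSet_of_differentiableOn (hpos : ∀ᵐ x ∂m, 0 ≤ x) {G : ℂ → ℂ} {c r t : ℝ}
    (hc : c ∈ interior (integrableExpSet id m))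
    (hG : DifferentiableOn ℂ G (Metric.ball (c : ℂ) r))
    (heq : G =ᶠ[𝓝 (c : ℂ)] complexMGF id m) (hct : c ≤ t) (htr : t < c + r) :
    t ∈ integrableExpSet id m := by
  have hmem : (t : ℂ) ∈ Metric.ball (c : ℂ) r := by
    rw [mem_ball_iff_norm, ← Complex.ofReal_sub, Complex.norm_real, Real.norm_eq_abs,
      abs_of_nonneg (sub_nonneg.2 hct)]
    linarith
  have hs := Complex.hasSum_taylorSeries_on_ball hG hmem
  set I : ℕ → ℝ := fun n => ∫ x, x ^ n * Real.exp (c * x) ∂m with hI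
  have hterm : ∀ n : ℕ, ((n.factorial : ℂ)⁻¹ • ((t : ℂ) - c) ^ n • iteratedDeriv n G c)
      = (((t - c) ^ n / n.factorial * I n : ℝ) : ℂ) := by
    intro n
    rw [heq.iteratedDeriv_eq, iteratedDeriv_complexMGF (by simpa using hc)]
    have : ∫ x, ((id x : ℝ) : ℂ) ^ n * Complex.exp (c * (id x : ℝ)) ∂m = ((I n : ℝ) : ℂ) := by
      rw [hI, ← integral_complex_ofReal]
      refine integral_congr_ae (Eventually.of_forall fun x => ?_)
      simp
    rw [this]
    simp only [smul_eq_mul]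
    push_cast
    ring
  simp_rw [hterm] at hs
  have hsum : Summable fun n : ℕ => (t - c) ^ n / n.factorial * I n := by
    exact_mod_cast hs.summable
  have hint : ∀ n, Integrable (fun x : ℝ => x ^ n * Real.exp (c * x)) m := fun n =>
    integrable_pow_mul_exp_of_mem_interior_integrableExpSet (X := id) hc n
  have htc : 0 ≤ t - c := sub_nonneg.2 hct
  refine ⟨by fun_prop, ?_⟩
  rw [hasFiniteIntegral_iff_ofReal (Eventually.of_forall fun x => (Real.exp_pos _).le)]
  have h1 : ∀ᵐ x ∂m, ENNReal.ofReal (Real.exp (t * id x))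
      = ∑' n : ℕ, ENNReal.ofReal ((t - c) ^ n / n.factorial * (x ^ n * Real.exp (c * x))) := by
    filter_upwards [hpos] with x hx
    have hsx : HasSum (fun n : ℕ => (t - c) ^ n / n.factorial * (x ^ n * Real.exp (c * x)))
        (Real.exp (t * x)) := by
      have := (NormedSpace.expSeries_div_hasSum_exp ((t - c) * x)).mul_right (Real.exp (c * x))
      rw [← Real.exp_eq_exp_ℝ, ← Real.exp_add] at this
      rw [show (t - c) * x + c * x = t * x by ring] at this
      have hfun : (fun n : ℕ => (t - c) ^ n / n.factorial * (x ^ n * Real.exp (c * x)))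
          = fun n : ℕ => ((t - c) * x) ^ n / n.factorial * Real.exp (c * x) := by
        ext n
        rw [mul_pow]
        ring
      rw [hfun]
      exact this
    rw [← ENNReal.ofReal_tsum_of_nonneg (fun n => by positivity) hsx.summable, hsx.tsum_eq]
    rfl
  rw [lintegral_congr_ae h1, lintegral_tsum fun n => by fun_prop]
  have h2 : ∀ n : ℕ, ∫⁻ x, ENNReal.ofReal ((t - c) ^ n / n.factorial * (x ^ n * Real.exp (c * x))) ∂m
      = ENNReal.ofReal ((t - c) ^ n / n.factorial * I n) := fun n => by
    rw [← ofReal_integral_eq_lintegral_ofReal ((hint n).const_mul _), integral_const_mul]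
    filter_upwards [hpos] with x hx
    simp only [Pi.zero_apply]
    positivity
  simp_rw [h2]
  exact hsum.tsum_ofReal_lt_top

variable [IsProbabilityMeasure m]

theorem Iic_zero_subset_integrableExpSet (hpos : ∀ᵐ x ∂m, 0 ≤ x) :
    Iic 0 ⊆ integrableExpSet id m := fun t ht => by
  refine Integrable.of_bound (C := 1) (by fun_prop) ?_
  filter_upwards [hpos] with x hx
  rw [Real.norm_eq_abs, Real.abs_exp, Real.exp_le_one_iff]
  exact mul_nonpos_of_nonpos_of_nonneg ht hx

theorem mem_interior_integrableExpSet_of_neg (hpos : ∀ᵐ x ∂m, 0 ≤ x) {t : ℝ} (ht : t < 0) :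
    t ∈ interior (integrableExpSet id m) :=
  interior_mono (Iic_zero_subset_integrableExpSet hpos) (by simpa using ht)

theorem norm_complexMGF_le_one (hpos : ∀ᵐ x ∂m, 0 ≤ x) {w : ℂ} (hw : w.re ≤ 0) :
    ‖complexMGF id m w‖ ≤ 1 := by
  have h := norm_integral_le_of_norm_le_const (μ := m) (C := 1)
    (f := fun x : ℝ => Complex.exp (w * (id x : ℝ))) ?_
  · simpa [complexMGF] using h
  · filter_upwards [hpos] with x hx
    rw [Complex.norm_exp, Real.exp_le_one_iff]
    simpa using mul_nonpos_of_nonpos_of_nonneg hw hx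

theorem continuousOn_complexMGF (hpos : ∀ᵐ x ∂m, 0 ≤ x) :
    ContinuousOn (complexMGF id m) {w | w.re ≤ 0} := by
  refine continuousOn_of_dominated (bound := fun _ => 1) ?_ ?_ (integrable_const _) ?_
  · intro w _
    fun_prop
  · intro w hw
    filter_upwards [hpos] with x hx
    rw [Complex.norm_exp, Real.exp_le_one_iff]
    simpa using mul_nonpos_of_nonpos_of_nonneg hw hx
  · exact Eventually.of_forall fun x => by fun_prop

end PositiveLaw

/-! ### The tempered stable subordinator -/

section TemperedStable

variable {α θ : ℝ}

/-- The moment generating function of the tempered stable subordinator, as an analytic function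
of `w` on the half-plane `re w < θ`. The parameter `θ` is factored out of the powers. -/
noncomputable def tsMGF (α θ : ℝ) (w : ℂ) : ℂ :=
  Complex.exp (-(2 * θ / α : ℝ) * ((1 - w / θ) ^ ((α / 2 : ℝ) : ℂ) - 1))

theorem re_one_sub_div_pos (hθ : 0 < θ) {w : ℂ} (hw : w.re < θ) : 0 < (1 - w / θ).re := by
  rw [Complex.sub_re, Complex.one_re, Complex.div_ofReal_re, sub_pos, div_lt_one hθ]
  exact hw

theorem cpow_ofReal_mul (hθ : 0 < θ) {z : ℂ} (hz : z ≠ 0) (p : ℝ) :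
    ((θ : ℂ) * z) ^ (p : ℂ) = ((θ ^ p : ℝ) : ℂ) * z ^ (p : ℂ) := by
  have h : (θ : ℂ) ≠ 0 := by exact_mod_cast hθ.ne'
  rw [Complex.ofReal_cpow hθ.le, Complex.cpow_def_of_ne_zero (mul_ne_zero h hz),
    Complex.cpow_def_of_ne_zero h, Complex.cpow_def_of_ne_zero hz, Complex.log_ofReal_mul hθ hz,
    ← Complex.exp_add, Complex.ofReal_log hθ.le]
  ring_nf

theorem tsMGF_eq (hθ : 0 < θ) {w : ℂ} (hw : w.re < θ) :
    Complex.exp (-(2 * (θ : ℂ) ^ (1 - (α : ℂ) / 2) / α) *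
      (((θ : ℂ) - w) ^ ((α : ℂ) / 2) - (θ : ℂ) ^ ((α : ℂ) / 2))) = tsMGF α θ w := by
  have h : (θ : ℂ) ≠ 0 := by exact_mod_cast hθ.ne'
  have hz : (1 - w / θ : ℂ) ≠ 0 := fun h0 => by
    simpa [h0] using re_one_sub_div_pos hθ hw
  have e1 : (θ : ℂ) - w = θ * (1 - w / θ) := by field_simp
  have e2 : (α : ℂ) / 2 = ((α / 2 : ℝ) : ℂ) := by push_cast; ring
  have e3 : (1 - (α : ℂ) / 2) = ((1 - α / 2 : ℝ) : ℂ) := by push_cast; ring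
  have e4 : (θ : ℂ) = ((θ ^ (1 - α / 2) : ℝ) : ℂ) * ((θ ^ (α / 2) : ℝ) : ℂ) := by
    rw [← Complex.ofReal_mul, ← Real.rpow_add hθ]
    simp
  rw [tsMGF, e1, e3, e2, cpow_ofReal_mul hθ hz, ← Complex.ofReal_cpow hθ.le,
    ← Complex.ofReal_cpow hθ.le]
  congr 1
  push_cast
  linear_combination (2 / (α : ℂ)) * ((1 - w / θ) ^ ((α : ℂ) / 2) - 1) * e4

theorem differentiableAt_tsMGF (hθ : 0 < θ) {w : ℂ} (hw : w.re < θ) :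
    DifferentiableAt ℂ (tsMGF α θ) w := by
  unfold tsMGF
  have hs : (1 - w / θ : ℂ) ∈ Complex.slitPlane := Or.inl (re_one_sub_div_pos hθ hw)
  have : DifferentiableAt ℂ (fun w : ℂ => (1 - w / θ) ^ ((α / 2 : ℝ) : ℂ)) w :=
    DifferentiableAt.cpow (by fun_prop) (by fun_prop) hs
  fun_prop

theorem analyticOnNhd_tsMGF (hθ : 0 < θ) : AnalyticOnNhd ℂ (tsMGF α θ) {w | w.re < θ} :=
  DifferentiableOn.analyticOnNhd (fun _ hw => (differentiableAt_tsMGF hθ hw).differentiableWithinAt)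
    (isOpen_lt Complex.continuous_re continuous_const)

theorem tsMGF_ofReal (hθ : 0 < θ) {x : ℝ} (hx : x < θ) :
    tsMGF α θ x = (Real.exp (-(2 * θ / α) * ((1 - x / θ) ^ (α / 2) - 1)) : ℝ) := by
  have h : 0 ≤ 1 - x / θ := by
    rw [sub_nonneg, div_le_one hθ]
    exact hx.le
  rw [tsMGF]
  push_cast [Complex.ofReal_cpow h]
  rfl

/-- On the left half-plane, `tsMGF` grows slower than the exponential of a power `< 2`. -/
theorem norm_tsMGF_neg_le (hα : α ∈ Ioo (0 : ℝ) 2) (hθ : 0 < θ) {z : ℂ} (hz : 1 ≤ ‖z‖) :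
    ‖tsMGF α θ (-z)‖
      ≤ Real.exp (2 * θ / α * ((1 + 1 / θ) ^ (α / 2) + 1) * ‖z‖ ^ (α / 2)) := by
  have hp : 0 < α / 2 := half_pos hα.1
  have hc : 0 < 2 * θ / α := div_pos (by linarith) hα.1
  refine (Complex.norm_exp_le_exp_norm _).trans (Real.exp_le_exp.2 ?_)
  rw [norm_mul, norm_neg, Complex.norm_real, Real.norm_eq_abs, abs_of_pos hc, mul_assoc]
  refine mul_le_mul_of_nonneg_left ?_ hc.le
  refine (norm_sub_le _ _).trans ?_
  have h1 : 1 ≤ ‖z‖ ^ (α / 2) := Real.one_le_rpow hz hp.le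
  have h2 : ‖(1 - -z / θ : ℂ) ^ ((α / 2 : ℝ) : ℂ)‖ ≤ (1 + 1 / θ) ^ (α / 2) * ‖z‖ ^ (α / 2) := by
    refine (Complex.norm_cpow_le _ _).trans ?_
    rw [← Real.mul_rpow (by positivity) (norm_nonneg _)]
    simp only [Complex.ofReal_re, Complex.ofReal_im, mul_zero, Real.exp_zero, div_one]
    refine Real.rpow_le_rpow (norm_nonneg _) ?_ hp.le
    refine (norm_sub_le _ _).trans ?_
    rw [norm_div, norm_neg, norm_one, Complex.norm_real, Real.norm_eq_abs, abs_of_pos hθ, add_mul,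
      one_mul, one_div_mul_eq_div]
    gcongr
  rw [norm_one, add_mul, one_mul]
  exact add_le_add h2 h1

variable {m : Measure ℝ}

theorem IsTemperedStable.ae_pos (h : IsTemperedStable α θ m) : ∀ᵐ x ∂m, 0 < x := by
  rw [ae_iff]
  convert! h.pos using 2
  ext x
  simp

theorem IsTemperedStable.complexMGF_eq_of_nonpos (h : IsTemperedStable α θ m)
    (hα : α ∈ Ioo (0 : ℝ) 2) (hθ : 0 < θ) {w : ℂ} (hw : w.re ≤ 0) :
    complexMGF id m w = tsMGF α θ w := by
  have := h.isProbabilityMeasure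
  have hpos : ∀ᵐ x ∂m, 0 ≤ x := h.ae_pos.mono fun _ => le_of_lt
  set f : ℂ → ℂ := fun z => complexMGF id m (-z) - tsMGF α θ (-z) with hf
  have hd1 : ∀ z : ℂ, 0 ≤ z.re → DifferentiableAt ℂ (fun z => tsMGF α θ (-z)) z := fun z hz =>
    (differentiableAt_tsMGF hθ (by simp; linarith)).comp z (by fun_prop)
  have hd : DiffContOnCl ℂ f {z | 0 < z.re} := by
    refine ⟨fun z hz => (DifferentiableAt.sub ?_ (hd1 z (le_of_lt hz))).differentiableWithinAt, ?_⟩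
    · have : DifferentiableAt ℂ (complexMGF id m) (-z) := by
        refine (analyticAt_complexMGF ?_).differentiableAt
        exact mem_interior_integrableExpSet_of_neg hpos (by simpa using hz)
      exact this.comp z (by fun_prop)
    · rw [Complex.closure_setOfPred_lt_re]
      refine ContinuousOn.sub ?_ fun z hz => (hd1 z hz).continuousAt.continuousWithinAt
      exact (continuousOn_complexMGF hpos).comp continuous_neg.continuousOn
        fun z hz => by simpa using hz
  have hle : ∀ z : ℂ, 0 < z.re → ‖complexMGF id m (-z)‖ ≤ 1 := fun z hz =>
    norm_complexMGF_le_one hpos (by simpa using hz.le)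
  have hp : 0 < α / 2 := half_pos hα.1
  have hc : 0 < 2 * θ / α := div_pos (by linarith) hα.1
  have hexp : ∃ c < (2 : ℝ), ∃ B, f =O[Bornology.cobounded ℂ ⊓ 𝓟 {z | 0 < z.re}]
      fun z => Real.exp (B * ‖z‖ ^ c) := by
    refine ⟨α / 2, by linarith [hα.2], 2 * θ / α * ((1 + 1 / θ) ^ (α / 2) + 1), ?_⟩
    refine Asymptotics.IsBigO.of_bound 2 ?_
    rw [eventually_inf_principal]
    filter_upwards [(tendsto_norm_cobounded_atTop (E := ℂ)).eventually_ge_atTop 1] with z hz hz0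
    rw [Real.norm_eq_abs, Real.abs_exp, two_mul]
    refine (norm_sub_le _ _).trans (add_le_add ((hle z hz0).trans ?_) (norm_tsMGF_neg_le hα hθ hz))
    exact Real.one_le_exp (by positivity)
  have hre : IsBoundedUnder (· ≤ ·) atTop fun x : ℝ => ‖f x‖ := by
    refine ⟨2, ?_⟩
    rw [eventually_map]
    filter_upwards [eventually_gt_atTop 0] with x hx
    refine (norm_sub_le _ _).trans ?_
    have h2 : ‖tsMGF α θ (-(x : ℂ))‖ ≤ 1 := by
      rw [← Complex.ofReal_neg, tsMGF_ofReal hθ (by linarith), Complex.norm_real,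
        Real.norm_eq_abs, Real.abs_exp, Real.exp_le_one_iff]
      have : 1 ≤ (1 - -x / θ) ^ (α / 2) := by
        refine Real.one_le_rpow ?_ hp.le
        rw [neg_div, sub_neg_eq_add, le_add_iff_nonneg_right]
        positivity
      nlinarith
    linarith [hle x (by simpa using hx)]
  have him : ∀ x : ℝ, ‖f (x * Complex.I)‖ ≤ 0 := by
    intro x
    have h1 : -((x : ℂ) * Complex.I) = ((-x : ℝ) : ℂ) * Complex.I := by push_cast; ring
    rw [norm_le_zero_iff, hf]
    simp only
    rw [sub_eq_zero, h1, complexMGF_id_mul_I, h.charFun_eq, ← tsMGF_eq hθ (by simpa using hθ)]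
    ring_nf
  have := PhragmenLindelof.right_half_plane_of_bounded_on_real hd hexp hre him
    (z := -w) (by simpa using hw)
  simpa [hf, sub_eq_zero] using this

theorem IsTemperedStable.Iio_subset (h : IsTemperedStable α θ m) (hα : α ∈ Ioo (0 : ℝ) 2)
    (hθ : 0 < θ) : Iio θ ⊆ integrableExpSet id m := by
  have := h.isProbabilityMeasure
  have hpos : ∀ᵐ x ∂m, 0 ≤ x := h.ae_pos.mono fun _ => le_of_lt
  intro t ht
  rcases le_or_gt t (-1) with h1 | h1
  · exact Iic_zero_subset_integrableExpSet hpos (by simp only [mem_Iic]; linarith)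
  refine mem_integrableExpSet_of_differentiableOn hpos (G := tsMGF α θ) (c := -1) (r := 1 + θ)
    (mem_interior_integrableExpSet_of_neg hpos (by norm_num)) ?_ ?_ h1.le (by
      simp only [mem_Iio] at ht; linarith)
  · intro z hz
    refine (differentiableAt_tsMGF hθ ?_).differentiableWithinAt
    rw [mem_ball_iff_norm] at hz
    have := (Complex.re_le_norm _).trans_lt hz
    simp at this
    linarith
  · have : ∀ᶠ w : ℂ in 𝓝 ((-1 : ℝ) : ℂ), w.re < 0 :=
      (isOpen_lt Complex.continuous_re continuous_const).eventually_mem (by simp)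
    filter_upwards [this] with w hw
    exact (h.complexMGF_eq_of_nonpos hα hθ hw.le).symm

theorem IsTemperedStable.mem_interior (h : IsTemperedStable α θ m) (hα : α ∈ Ioo (0 : ℝ) 2)
    (hθ : 0 < θ) {t : ℝ} (ht : t < θ) : t ∈ interior (integrableExpSet id m) :=
  interior_mono (h.Iio_subset hα hθ) (by simpa using ht)

theorem IsTemperedStable.complexMGF_eq (h : IsTemperedStable α θ m)
    (hα : α ∈ Ioo (0 : ℝ) 2) (hθ : 0 < θ) {w : ℂ} (hw : w.re < θ) :
    complexMGF id m w = tsMGF α θ w := by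
  have h1 : AnalyticOnNhd ℂ (complexMGF id m) {w | w.re < θ} := fun z hz =>
    analyticAt_complexMGF (h.mem_interior hα hθ hz)
  refine h1.eqOn_of_preconnected_of_eventuallyEq (analyticOnNhd_tsMGF hθ)
    (convex_halfSpace_re_lt θ).isPreconnected (z₀ := -1) (by simp; linarith) ?_ hw
  have : ∀ᶠ w : ℂ in 𝓝 (-1 : ℂ), w.re < 0 :=
    (isOpen_lt Complex.continuous_re continuous_const).eventually_mem (by simp)
  filter_upwards [this] with w hw
  exact h.complexMGF_eq_of_nonpos hα hθ hw.le

theorem IsTemperedStable.cgf_eq (h : IsTemperedStable α θ m)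
    (hα : α ∈ Ioo (0 : ℝ) 2) (hθ : 0 < θ) {x : ℝ} (hx : x < θ) :
    cgf id m x = -(2 * θ / α) * ((1 - x / θ) ^ (α / 2) - 1) := by
  have h1 := h.complexMGF_eq hα hθ (w := x) (by simpa using hx)
  rw [complexMGF_ofReal, tsMGF_ofReal hθ hx, Complex.ofReal_inj] at h1
  rw [cgf, h1, Real.log_exp]

theorem IsTemperedStable.hasDerivAt_cgf (h : IsTemperedStable α θ m)
    (hα : α ∈ Ioo (0 : ℝ) 2) (hθ : 0 < θ) {x : ℝ} (hx : x < θ) :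
    HasDerivAt (cgf id m) ((1 - x / θ) ^ (α / 2 - 1)) x := by
  have hb : 0 < 1 - x / θ := by rwa [sub_pos, div_lt_one hθ]
  have heq : cgf id m =ᶠ[𝓝 x] fun x => -(2 * θ / α) * ((1 - x / θ) ^ (α / 2) - 1) := by
    filter_upwards [Iio_mem_nhds hx] with y hy using h.cgf_eq hα hθ hy
  refine HasDerivAt.congr_of_eventuallyEq ?_ heq
  have h1 : HasDerivAt (fun x : ℝ => 1 - x / θ) (-(1 / θ)) x :=
    ((hasDerivAt_id x).div_const θ).const_sub 1
  refine (((h1.rpow_const (p := α / 2) (Or.inl hb.ne')).sub_const 1).const_mul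
    (-(2 * θ / α))).congr_deriv ?_
  have := hα.1.ne'
  field_simp

/-- The exponential moments beyond `θ` are infinite: otherwise the cumulant generating function
would be continuously differentiable at `θ`, where the derivative `(1 - x / θ) ^ (α / 2 - 1)`
blows up. -/
theorem IsTemperedStable.integrableExpSet_subset (h : IsTemperedStable α θ m)
    (hα : α ∈ Ioo (0 : ℝ) 2) (hθ : 0 < θ) : integrableExpSet id m ⊆ Iic θ := by
  have := h.isProbabilityMeasure
  intro s hs
  by_contra hlt
  rw [mem_Iic, not_le] at hlt
  have hsub : Iio s ⊆ integrableExpSet id m := fun t ht => by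
    rcases le_or_gt t 0 with h0 | h0
    · exact h.Iio_subset hα hθ (h0.trans_lt hθ)
    · exact integrable_exp_mul_of_nonneg_of_le hs h0.le (le_of_lt ht)
  have hmem : θ ∈ interior (integrableExpSet id m) := interior_mono hsub (by simpa using hlt)
  have hcont : ContinuousAt (deriv (cgf id m)) θ := (analyticAt_cgf hmem).deriv.continuousAt
  have hl : Tendsto (deriv (cgf id m)) (𝓝[<] θ) atTop := by
    have h1 : Tendsto (fun x : ℝ => 1 - x / θ) (𝓝[<] θ) (𝓝[>] 0) := by
      refine tendsto_nhdsWithin_iff.2 ⟨?_, ?_⟩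
      · refine Tendsto.mono_left ?_ nhdsWithin_le_nhds
        exact Continuous.tendsto' (by fun_prop) _ _ (by field_simp; simp)
      · filter_upwards [self_mem_nhdsWithin] with x hx
        rw [mem_Ioi, sub_pos, div_lt_one hθ]
        exact hx
    refine Tendsto.congr' ?_ ((tendsto_rpow_neg_nhdsGT_zero (y := α / 2 - 1)
      (by linarith [hα.2])).comp h1)
    filter_upwards [self_mem_nhdsWithin] with x hx
    exact (h.hasDerivAt_cgf hα hθ hx).deriv.symm
  exact not_tendsto_nhds_of_tendsto_atTop hl _ (hcont.tendsto.mono_left nhdsWithin_le_nhds)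

end TemperedStable

/-! ### Normal mean-variance mixtures -/

section Mixture

/-- The law of `b (T - 1) + τ ε √T` with `T` of law `m` and `ε` standard normal, independent. -/
noncomputable def mixLaw (m : Measure ℝ) (b τ : ℝ) : Measure ℝ :=
  (m.prod (gaussianReal 0 1)).map (fun p => b * (p.1 - 1) + τ * p.2 * √p.1)

variable {m : Measure ℝ} {b τ : ℝ}

theorem complexMGF_gaussianReal_zero_one (z : ℂ) :
    ∫ y : ℝ, Complex.exp (z * y) ∂gaussianReal 0 1 = Complex.exp (z ^ 2 / 2) := by
  have := complexMGF_id_gaussianReal (μ := 0) (v := 1) z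
  simpa [complexMGF] using this

theorem mgf_gaussianReal_zero_one (r : ℝ) :
    ∫ y : ℝ, Real.exp (r * y) ∂gaussianReal 0 1 = Real.exp (r ^ 2 / 2) := by
  have := congrFun (mgf_id_gaussianReal (μ := 0) (v := 1)) r
  simpa [mgf] using this

/-- The exponential moments of a mixture are those of the mixing law at a quadratic argument,
obtained by integrating out the Gaussian variable. -/
theorem mem_integrableExpSet_mixLaw (hpos : ∀ᵐ x ∂m, 0 ≤ x) {r : ℝ} :
    r ∈ integrableExpSet id (mixLaw m b τ) ↔
      r * b + r ^ 2 * τ ^ 2 / 2 ∈ integrableExpSet id m := by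
  have e : (fun p : ℝ × ℝ => Real.exp (r * (b * (p.1 - 1) + τ * p.2 * √p.1)))
      = fun p => Real.exp (r * b * (p.1 - 1)) * Real.exp (r * τ * √p.1 * p.2) := by
    ext p
    rw [← Real.exp_add]
    ring_nf
  have h1 : r ∈ integrableExpSet id (mixLaw m b τ) ↔
      Integrable (fun p : ℝ × ℝ => Real.exp (r * (b * (p.1 - 1) + τ * p.2 * √p.1)))
        (m.prod (gaussianReal 0 1)) :=
    integrable_map_measure (by fun_prop) (by fun_prop)
  rw [h1, e, integrable_prod_iff (by fun_prop)]
  have h2 : ∀ᵐ x ∂m, Integrable (fun y => Real.exp (r * b * (x - 1)) *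
      Real.exp (r * τ * √x * y)) (gaussianReal 0 1) :=
    Eventually.of_forall fun x => (integrable_exp_mul_gaussianReal _).const_mul _
  rw [and_iff_right h2]
  have h3 : (fun x => ∫ y, ‖Real.exp (r * b * (x - 1)) * Real.exp (r * τ * √x * y)‖
      ∂gaussianReal 0 1) =ᵐ[m]
      fun x => Real.exp (-(r * b)) * Real.exp ((r * b + r ^ 2 * τ ^ 2 / 2) * x) := by
    filter_upwards [hpos] with x hx
    simp only [norm_mul, Real.norm_eq_abs, Real.abs_exp]
    rw [integral_const_mul, mgf_gaussianReal_zero_one, ← Real.exp_add, ← Real.exp_add, mul_pow,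
      Real.sq_sqrt hx]
    ring_nf
  rw [integrable_congr h3, integrable_const_mul_iff (Real.exp_pos _).ne'.isUnit]
  rfl

variable [IsProbabilityMeasure m]

instance isProbabilityMeasure_mixLaw : IsProbabilityMeasure (mixLaw m b τ) :=
  Measure.isProbabilityMeasure_map (by fun_prop)

theorem complexMGF_mixLaw (hpos : ∀ᵐ x ∂m, 0 ≤ x) {z : ℂ}
    (hz : z.re ∈ integrableExpSet id (mixLaw m b τ)) :
    complexMGF id (mixLaw m b τ) z
      = Complex.exp (-(z * b)) * complexMGF id m (z * b + z ^ 2 * (τ : ℂ) ^ 2 / 2) := by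
  have hint : Integrable (fun x : ℝ => Complex.exp (z * (id x : ℝ))) (mixLaw m b τ) :=
    integrable_cexp_mul_of_re_mem_integrableExpSet aemeasurable_id hz
  have hmeas : AEMeasurable (fun p : ℝ × ℝ => b * (p.1 - 1) + τ * p.2 * √p.1)
      (m.prod (gaussianReal 0 1)) := by fun_prop
  rw [mixLaw, integrable_map_measure (by fun_prop) hmeas] at hint
  rw [complexMGF, mixLaw, integral_map hmeas (by fun_prop)]
  refine (integral_prod _ hint).trans ?_
  rw [complexMGF, ← integral_const_mul]
  refine integral_congr_ae ?_
  filter_upwards [hpos] with x hx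
  have e : ∀ y : ℝ, Complex.exp (z * ((id (b * (x - 1) + τ * y * √x) : ℝ) : ℂ))
      = Complex.exp (z * b * (x - 1)) * Complex.exp (z * τ * (√x : ℝ) * y) := fun y => by
    rw [← Complex.exp_add]
    simp only [id]
    push_cast
    ring_nf
  have hsq : ((√x : ℝ) : ℂ) ^ 2 = x := by
    rw [← Complex.ofReal_pow, Real.sq_sqrt hx]
  simp only [Function.comp_apply, e]
  rw [integral_const_mul, complexMGF_gaussianReal_zero_one, ← Complex.exp_add, ← Complex.exp_add,
    mul_pow, mul_pow, hsq]
  congr 1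
  simp only [id]
  ring

theorem gaussianPDF_zero_one_anti {x y : ℝ} (h : |x| ≤ |y|) :
    gaussianPDF 0 1 y ≤ gaussianPDF 0 1 x := by
  refine ENNReal.ofReal_le_ofReal ?_
  simp only [gaussianPDFReal_def]
  gcongr ?_ * Real.exp ?_
  have := sq_le_sq.2 h
  simp only [sub_zero, NNReal.coe_one, mul_one]
  linarith

/-- The mass which a nondegenerate mixture gives to the intervals `(x, x + h]` is at least
proportional to `h`. -/
theorem exists_mul_le_mixLaw_Ioc (hpos : ∀ᵐ x ∂m, 0 < x) (hτ : 0 < τ) (x : ℝ) :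
    ∃ c > 0, ∀ h ∈ Icc (0 : ℝ) 1, c * h ≤ (mixLaw m b τ).real (Ioc x (x + h)) := by
  set l : ℝ → ENNReal := fun t => gaussianPDF 0 1 (|(x - b * (t - 1)) / (τ * √t)| + 1 / (τ * √t))
    * ENNReal.ofReal (1 / (τ * √t)) with hl
  have hlm : Measurable l := by
    have := measurable_gaussianPDF 0 1
    have h2 : Measurable fun t : ℝ => |(x - b * (t - 1)) / (τ * √t)| + 1 / (τ * √t) :=
      (Measurable.abs (by fun_prop)).add (by fun_prop)
    exact (this.comp h2).mul (by fun_prop)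
  have hlpos : ∀ t > 0, 0 < l t := fun t ht => by
    have : 0 < τ * √t := mul_pos hτ (Real.sqrt_pos.2 ht)
    exact ENNReal.mul_pos (gaussianPDF_pos 0 one_ne_zero _).ne'
      (ENNReal.ofReal_pos.2 (by positivity)).ne'
  have hmeas : Measurable (fun p : ℝ × ℝ => b * (p.1 - 1) + τ * p.2 * √p.1) := by fun_prop
  have hle : ∀ h ∈ Icc (0 : ℝ) 1,
      ENNReal.ofReal h * ∫⁻ t, l t ∂m ≤ mixLaw m b τ (Ioc x (x + h)) := by
    intro h hh
    rw [mixLaw, Measure.map_apply hmeas measurableSet_Ioc,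
      Measure.prod_apply (hmeas measurableSet_Ioc), ← lintegral_const_mul _ hlm]
    refine lintegral_mono_ae ?_
    filter_upwards [hpos] with t ht
    have hk : 0 < τ * √t := mul_pos hτ (Real.sqrt_pos.2 ht)
    set k := τ * √t with hkdef
    set u := (x - b * (t - 1)) / k with hu
    have hsub : Ioc u (u + h * (1 / k)) ⊆ Prod.mk t ⁻¹'
        ((fun p : ℝ × ℝ => b * (p.1 - 1) + τ * p.2 * √p.1) ⁻¹' Ioc x (x + h)) := by
      intro y hy
      have hy1 : x - b * (t - 1) < y * k := (div_lt_iff₀ hk).1 hy.1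
      have hy2 : y ≤ (x + h - b * (t - 1)) / k := hy.2.trans_eq (by rw [hu]; field_simp; ring)
      rw [le_div_iff₀ hk] at hy2
      have e : τ * y * √t = y * k := by rw [hkdef]; ring
      simp only [mem_preimage, mem_Ioc, e]
      constructor <;> linarith
    refine le_trans ?_ (measure_mono hsub)
    rw [gaussianReal_apply 0 one_ne_zero]
    have hconst : ∫⁻ _ in Ioc u (u + h * (1 / k)), gaussianPDF 0 1 (|u| + 1 / k)
        = ENNReal.ofReal h * l t := by
      rw [setLIntegral_const, Real.volume_Ioc, add_sub_cancel_left, ENNReal.ofReal_mul hh.1, hl]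
      ring
    rw [← hconst]
    refine setLIntegral_mono (measurable_gaussianPDF 0 1) fun y hy => ?_
    refine gaussianPDF_zero_one_anti ?_
    have h1k : 0 < 1 / k := by positivity
    have : h * (1 / k) ≤ 1 / k := mul_le_of_le_one_left h1k.le hh.2
    rw [abs_of_nonneg (add_nonneg (abs_nonneg u) h1k.le), abs_le]
    constructor
    · linarith [hy.1, neg_abs_le u]
    · linarith [hy.2, le_abs_self u]
  have hI0 : ∫⁻ t, l t ∂m ≠ 0 := by
    rw [Ne, lintegral_eq_zero_iff hlm]
    intro h0
    have : ∀ᵐ t ∂m, False := by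
      filter_upwards [h0, hpos] with t h1 h2
      exact (hlpos t h2).ne' h1
    simp at this
    exact IsProbabilityMeasure.ne_zero m this
  have hI1 : ∫⁻ t, l t ∂m ≠ ⊤ := by
    have := (hle 1 (by simp)).trans prob_le_one
    rw [ENNReal.ofReal_one, one_mul] at this
    exact (this.trans_lt ENNReal.one_lt_top).ne
  refine ⟨(∫⁻ t, l t ∂m).toReal, ENNReal.toReal_pos hI0 hI1, fun h hh => ?_⟩
  have := ENNReal.toReal_mono (measure_ne_top _ _) (hle h hh)
  rwa [ENNReal.toReal_mul, ENNReal.toReal_ofReal hh.1, mul_comm] at this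

end Mixture

section MixtureTS

variable {α θ b τ : ℝ} {m : Measure ℝ}

theorem IsTemperedStable.zero_mem_interior_mixLaw (h : IsTemperedStable α θ m)
    (hα : α ∈ Ioo (0 : ℝ) 2) (hθ : 0 < θ) : 0 ∈ interior (integrableExpSet id (mixLaw m b τ)) := by
  have := h.isProbabilityMeasure
  rw [mem_interior_iff_mem_nhds]
  have hc : Tendsto (fun r : ℝ => r * b + r ^ 2 * τ ^ 2 / 2) (𝓝 0) (𝓝 0) :=
    Continuous.tendsto' (by fun_prop) _ _ (by simp)
  filter_upwards [hc (Iio_mem_nhds hθ)] with r hr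
  exact (mem_integrableExpSet_mixLaw (h.ae_pos.mono fun _ => le_of_lt)).2
    (h.Iio_subset hα hθ hr)

theorem IsTemperedStable.memLp_mixLaw (h : IsTemperedStable α θ m)
    (hα : α ∈ Ioo (0 : ℝ) 2) (hθ : 0 < θ) : MemLp id 2 (mixLaw m b τ) :=
  memLp_of_mem_interior_integrableExpSet (h.zero_mem_interior_mixLaw hα hθ) 2

theorem IsTemperedStable.integrable_mixLaw (h : IsTemperedStable α θ m)
    (hα : α ∈ Ioo (0 : ℝ) 2) (hθ : 0 < θ) : Integrable id (mixLaw m b τ) :=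
  have := h.isProbabilityMeasure
  (h.memLp_mixLaw hα hθ).integrable one_le_two

theorem IsTemperedStable.cgf_mixLaw (h : IsTemperedStable α θ m)
    (hα : α ∈ Ioo (0 : ℝ) 2) (hθ : 0 < θ) {r : ℝ} (hr : r * b + r ^ 2 * τ ^ 2 / 2 < θ) :
    cgf id (mixLaw m b τ) r = -(r * b) + cgf id m (r * b + r ^ 2 * τ ^ 2 / 2) := by
  have := h.isProbabilityMeasure
  have hpos : ∀ᵐ x ∂m, 0 ≤ x := h.ae_pos.mono fun _ => le_of_lt
  have hm := h.Iio_subset hα hθ hr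
  have h1 := complexMGF_mixLaw (b := b) (τ := τ) hpos (z := r)
    ((mem_integrableExpSet_mixLaw hpos).2 (by simpa using hm))
  have h2 : (r * b + r ^ 2 * (τ : ℂ) ^ 2 / 2 : ℂ) = ((r * b + r ^ 2 * τ ^ 2 / 2 : ℝ) : ℂ) := by
    push_cast
    ring
  rw [h2, complexMGF_ofReal, complexMGF_ofReal, ← Complex.ofReal_mul, ← Complex.ofReal_neg,
    ← Complex.ofReal_exp, ← Complex.ofReal_mul, Complex.ofReal_inj] at h1
  rw [cgf, h1, Real.log_mul (Real.exp_pos _).ne' (mgf_pos hm).ne', Real.log_exp, cgf]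

theorem IsTemperedStable.variance_mixLaw (h : IsTemperedStable α θ m)
    (hα : α ∈ Ioo (0 : ℝ) 2) (hθ : 0 < θ) :
    Var[id; mixLaw m b τ] = b ^ 2 * ((2 - α) / (2 * θ)) + τ ^ 2 := by
  have := h.isProbabilityMeasure
  have hmem := h.zero_mem_interior_mixLaw (b := b) (τ := τ) hα hθ
  have hvar : Var[id; mixLaw m b τ] = iteratedDeriv 2 (cgf id (mixLaw m b τ)) 0 := by
    rw [iteratedDeriv_two_cgf hmem, variance_eq_sub (h.memLp_mixLaw hα hθ), deriv_cgf_zero hmem]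
    simp
  set f : ℝ → ℝ := fun r => r * b + r ^ 2 * τ ^ 2 / 2 with hf
  have hfd : ∀ r, HasDerivAt f (b + r * τ ^ 2) r := fun r => by
    have h1 := ((hasDerivAt_id r).mul_const b).add
      ((((hasDerivAt_id r).pow 2).mul_const (τ ^ 2)).div_const 2)
    refine h1.congr_deriv ?_
    simp
    ring
  have hev : ∀ᶠ r in 𝓝 0, f r < θ := by
    have hc : Tendsto f (𝓝 0) (𝓝 0) := Continuous.tendsto' (by fun_prop) _ _ (by simp [hf])
    exact hc (Iio_mem_nhds hθ)
  have hd1 : deriv (cgf id (mixLaw m b τ)) =ᶠ[𝓝 0]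
      fun r => -b + (1 - f r / θ) ^ (α / 2 - 1) * (b + r * τ ^ 2) := by
    filter_upwards [hev.eventually_nhds] with r hr
    have heq : cgf id (mixLaw m b τ) =ᶠ[𝓝 r] fun r => -(r * b) + cgf id m (f r) := by
      filter_upwards [hr] with s hs using h.cgf_mixLaw hα hθ hs
    rw [heq.deriv_eq]
    have h1 := (h.hasDerivAt_cgf hα hθ hr.self_of_nhds).comp r (hfd r)
    have h2 : HasDerivAt (fun r : ℝ => -(r * b)) (-b) r := by
      simpa using ((hasDerivAt_id' r).mul_const b).fun_neg
    exact (h2.add h1).deriv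
  rw [hvar, iteratedDeriv_succ, iteratedDeriv_one, hd1.deriv_eq]
  have hf0 : f 0 = 0 := by simp [hf]
  have h3 : HasDerivAt (fun r : ℝ => 1 - f r / θ) (-((b + 0 * τ ^ 2) / θ)) 0 :=
    ((hfd 0).div_const θ).const_sub 1
  have h4 := h3.rpow_const (p := α / 2 - 1) (Or.inl (by simp [hf0]))
  have h5 : HasDerivAt (fun r : ℝ => b + r * τ ^ 2) (τ ^ 2) 0 := by
    simpa using ((hasDerivAt_id (0 : ℝ)).mul_const (τ ^ 2)).const_add b
  rw [((h4.fun_mul h5).const_add (-b)).deriv]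
  simp [hf0]
  field_simp
  ring

end MixtureTS

/-! ### The moment generating function of the standard NTS law on vertical lines -/

section Bounds

/-- The square of the coefficient `gammaCoef`, as a polynomial in `β`. -/
noncomputable def gammaSq (α θ β : ℝ) : ℝ := 1 - β ^ 2 * ((2 - α) / (2 * θ))

/-- The base of the fractional powers in the moment generating function of `stdNTSLaw1`
at the point `-s`. -/
noncomputable def ntsBase (α θ β : ℝ) (s : ℂ) : ℂ :=
  1 + s * β / θ - gammaSq α θ β * (s ^ 2 / (2 * θ))

/-- The value of `ntsBase` at a real point. -/
noncomputable def ntsBaseReal (α θ β δ : ℝ) : ℝ :=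
  1 + δ * β / θ - gammaSq α θ β * (δ ^ 2 / (2 * θ))

/-- The function `s ↦ E[exp (-s Ξ)]` for `Ξ` with law `stdNTSLaw1 α θ β`, in closed form. -/
noncomputable def ntsMGF (α θ β : ℝ) (s : ℂ) : ℂ :=
  Complex.exp (s * β - (2 * θ / α : ℝ) * (ntsBase α θ β s ^ ((α / 2 : ℝ) : ℂ) - 1))

/-- The logarithmic derivative of `ntsMGF` in `β`. -/
noncomputable def ntsLogDeriv (α θ β : ℝ) (s : ℂ) : ℂ :=
  s - ntsBase α θ β s ^ ((α / 2 - 1 : ℝ) : ℂ) * (s + (β * ((2 - α) / (2 * θ)) : ℝ) * s ^ 2)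

/-- The point `δ + i u` of the vertical line with abscissa `δ`. -/
def vline (δ u : ℝ) : ℂ := ⟨δ, u⟩

variable {α θ β δ u : ℝ}

theorem vline_eq (δ u : ℝ) : vline δ u = δ + u * Complex.I := Complex.mk_eq_add_mul_I δ u

@[simp] theorem vline_re (δ u : ℝ) : (vline δ u).re = δ := rfl

@[simp] theorem vline_im (δ u : ℝ) : (vline δ u).im = u := rfl

theorem continuous_vline (δ : ℝ) : Continuous (vline δ) := by
  have : vline δ = fun u : ℝ => (δ : ℂ) + u * Complex.I := funext (vline_eq δ)
  rw [this]
  fun_prop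

theorem le_norm_vline : δ ≤ ‖vline δ u‖ :=
  (le_abs_self _).trans (Complex.abs_re_le_norm (vline δ u))

theorem vline_ne_zero (hδ : 0 < δ) : vline δ u ≠ 0 := fun h => by
  have := congrArg Complex.re h
  simp at this
  exact hδ.ne' this

theorem ntsBase_vline_re :
    (ntsBase α θ β (vline δ u)).re = ntsBaseReal α θ β δ + gammaSq α θ β * (u ^ 2 / (2 * θ)) := by
  have h2 : (2 * (θ : ℂ)) = ((2 * θ : ℝ) : ℂ) := by push_cast; rfl
  rw [ntsBase, ntsBaseReal, h2]
  simp only [Complex.add_re, Complex.sub_re, Complex.div_ofReal_re, Complex.div_ofReal_im,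
    Complex.one_re, vline_re, pow_two, Complex.mul_re, Complex.mul_im, vline_im,
    Complex.ofReal_re, Complex.ofReal_im]
  ring

theorem ntsBase_vline_im :
    (ntsBase α θ β (vline δ u)).im = u * ((β - gammaSq α θ β * δ) / θ) := by
  have h2 : (2 * (θ : ℂ)) = ((2 * θ : ℝ) : ℂ) := by push_cast; rfl
  rw [ntsBase, h2]
  simp only [Complex.add_im, Complex.sub_im, Complex.div_ofReal_re, Complex.div_ofReal_im,
    Complex.one_im, vline_re, pow_two, Complex.mul_re, Complex.mul_im, vline_im,
    Complex.ofReal_re, Complex.ofReal_im]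
  ring

theorem ntsBase_vline_re_pos (hθ : 0 < θ) (hg : 0 < gammaSq α θ β)
    (hA : 0 ≤ ntsBaseReal α θ β δ) (hu : u ≠ 0) : 0 < (ntsBase α θ β (vline δ u)).re := by
  rw [ntsBase_vline_re]
  have : 0 < u ^ 2 := by positivity
  positivity

/-- On a vertical line in the closed region of convergence, `ntsBase` vanishes at most to first
order: where its real part is small, the derivative of its imaginary part is not. -/
theorem mul_le_norm_ntsBase (hθ : 0 < θ) (hg : 0 < gammaSq α θ β) (hδ : 0 < δ)
    (hu : 0 < u) (hu1 : u ≤ 1) :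
    min (1 / 2) (1 / (2 * δ)) * u ≤ ‖ntsBase α θ β (vline δ u)‖ := by
  rcases le_or_gt (1 / 2) (ntsBaseReal α θ β δ) with h | h
  · have h1 := Complex.re_le_norm (ntsBase α θ β (vline δ u))
    have h2 : 0 ≤ gammaSq α θ β * (u ^ 2 / (2 * θ)) := by positivity
    rw [ntsBase_vline_re] at h1
    have h3 : min (1 / 2) (1 / (2 * δ)) * u ≤ 1 / 2 * 1 :=
      mul_le_mul (min_le_left _ _) hu1 hu.le (by norm_num)
    linarith
  · have h1 := Complex.abs_im_le_norm (ntsBase α θ β (vline δ u))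
    refine le_trans ?_ h1
    rw [ntsBase_vline_im, abs_mul, abs_of_pos hu, mul_comm u]
    refine mul_le_mul_of_nonneg_right ((min_le_right _ _).trans ?_) hu.le
    have e : ntsBaseReal α θ β δ = 1 + δ * ((β - gammaSq α θ β * δ) / θ)
        + gammaSq α θ β * δ ^ 2 / (2 * θ) := by
      rw [ntsBaseReal]
      field_simp
      ring
    have h2 : 0 ≤ gammaSq α θ β * δ ^ 2 / (2 * θ) := by positivity
    have h3 : δ * ((β - gammaSq α θ β * δ) / θ) ≤ -(1 / 2) := by linarith
    refine le_trans ?_ (neg_le_abs _)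
    rw [div_le_iff₀ (by positivity)]
    nlinarith

theorem re_cpow_ge (hα : α ∈ Ioo (0 : ℝ) 2) {z : ℂ} (hz : 0 < z.re) :
    Real.cos (Real.pi / 2 * (α / 2)) * ‖z‖ ^ (α / 2) ≤ (z ^ ((α / 2 : ℝ) : ℂ)).re := by
  rw [Complex.cpow_ofReal_re, mul_comm]
  refine mul_le_mul_of_nonneg_left ?_ (by positivity)
  have h1 : |z.arg| ≤ Real.pi / 2 := Complex.abs_arg_le_pi_div_two_iff.2 hz.le
  have hp : 0 < α / 2 := half_pos hα.1
  rw [← Real.cos_abs (z.arg * (α / 2)), abs_mul, abs_of_pos hp]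
  refine Real.cos_le_cos_of_nonneg_of_le_pi (by positivity) ?_ (by gcongr)
  nlinarith [Real.pi_pos, hα.2]

theorem norm_ntsMGF_le (hα : α ∈ Ioo (0 : ℝ) 2) (hθ : 0 < θ) {g₀ : ℝ} (hg₀ : 0 < g₀)
    (hg : g₀ ≤ gammaSq α θ β) (hA : 0 ≤ ntsBaseReal α θ β δ) (hu : 0 < u) :
    ‖ntsMGF α θ β (vline δ u)‖ ≤ Real.exp (δ * β + 2 * θ / α) * Real.exp (-(2 * θ / α *
      (Real.cos (Real.pi / 2 * (α / 2)) * (g₀ / (2 * θ)) ^ (α / 2))) * u ^ α) := by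
  have hre := ntsBase_vline_re_pos hθ (hg₀.trans_le hg) hA hu.ne'
  have h1 := re_cpow_ge hα hre
  have hcos : 0 ≤ Real.cos (Real.pi / 2 * (α / 2)) :=
    Real.cos_nonneg_of_mem_Icc ⟨by nlinarith [Real.pi_pos, hα.1], by nlinarith [Real.pi_pos, hα.2]⟩
  have h2 : (g₀ / (2 * θ)) ^ (α / 2) * u ^ α ≤ ‖ntsBase α θ β (vline δ u)‖ ^ (α / 2) := by
    have e : u ^ α = (u ^ 2) ^ (α / 2) := by
      rw [← Real.rpow_natCast, ← Real.rpow_mul hu.le]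
      congr 1
      push_cast
      ring
    rw [e, ← Real.mul_rpow (by positivity) (by positivity)]
    refine Real.rpow_le_rpow (by positivity) ?_ (half_pos hα.1).le
    refine le_trans ?_ (Complex.re_le_norm _)
    rw [ntsBase_vline_re]
    have : g₀ / (2 * θ) * u ^ 2 ≤ gammaSq α θ β * (u ^ 2 / (2 * θ)) := by
      rw [div_mul_eq_mul_div, mul_div_assoc]
      gcongr
    linarith
  rw [ntsMGF, Complex.norm_exp, ← Real.exp_add, Real.exp_le_exp]
  have hc : 0 < 2 * θ / α := div_pos (by linarith) hα.1
  have h3 := mul_le_mul_of_nonneg_left h2 hcos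
  simp only [Complex.sub_re, Complex.re_ofReal_mul, Complex.re_mul_ofReal, vline_re,
    Complex.one_re]
  nlinarith

/-- A function integrable on `(0, ∞)` which dominates all the Fourier integrands: it allows for
the singularity `u ^ (α / 2 - 1)` at `0` and has the decay of the moment generating function. -/
noncomputable def fourierBound (α c u : ℝ) : ℝ :=
  (1 + u ^ 2) * (1 + u ^ (α / 2 - 1)) * Real.exp (-c * u ^ α)

theorem integrableOn_fourierBound (hα : α ∈ Ioo (0 : ℝ) 2) {c : ℝ} (hc : 0 < c) :
    IntegrableOn (fourierBound α c) (Ioi 0) := by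
  have h : ∀ s : ℝ, -1 < s → IntegrableOn (fun u : ℝ => u ^ s * Real.exp (-c * u ^ α)) (Ioi 0) :=
    fun s hs => integrableOn_rpow_mul_exp_neg_mul_rpow hs hα.1 hc
  have hα1 := hα.1
  refine ((((h 0 (by norm_num)).add (h (α / 2 - 1) (by linarith))).add (h 2 (by norm_num))).add
    (h (2 + (α / 2 - 1)) (by linarith))).congr_fun (fun u hu => ?_) measurableSet_Ioi
  have hu : 0 < u := hu
  simp only [Pi.add_apply, fourierBound, Real.rpow_zero, Real.rpow_add hu, Real.rpow_two]
  ring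

theorem norm_vline_sq (δ u : ℝ) : ‖vline δ u‖ ^ 2 = δ ^ 2 + u ^ 2 := by
  rw [Complex.sq_norm, Complex.normSq_apply, vline_re, vline_im]
  ring

theorem norm_ntsBase_rpow_le (hα : α ∈ Ioo (0 : ℝ) 2) (hθ : 0 < θ) {g₀ δ₁ : ℝ} (hg₀ : 0 < g₀)
    (hg : g₀ ≤ gammaSq α θ β) (hδ : 0 < δ) (hδ₁ : δ ≤ δ₁) (hA : 0 ≤ ntsBaseReal α θ β δ)
    (hu : 0 < u) :
    ‖ntsBase α θ β (vline δ u)‖ ^ (α / 2 - 1)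
      ≤ (|min (1 / 2) (1 / (2 * δ₁))| ^ (α / 2 - 1) + (g₀ / (2 * θ)) ^ (α / 2 - 1))
        * (1 + u ^ (α / 2 - 1)) := by
  set κ := min (1 / 2) (1 / (2 * δ₁)) with hκ
  have hδ1 : 0 < δ₁ := hδ.trans_le hδ₁
  have hp1 : α / 2 - 1 ≤ 0 := by linarith [hα.2]
  have hg' : 0 < gammaSq α θ β := hg₀.trans_le hg
  have hκ0 : 0 < κ := lt_min (by norm_num) (by positivity)
  have hup : 0 < u ^ (α / 2 - 1) := Real.rpow_pos_of_pos hu _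
  have hk2 : 0 < (g₀ / (2 * θ)) ^ (α / 2 - 1) := Real.rpow_pos_of_pos (by positivity) _
  have hk1 : 0 < κ ^ (α / 2 - 1) := Real.rpow_pos_of_pos hκ0 _
  rw [abs_of_pos hκ0]
  rcases le_or_gt u 1 with h | h
  · have h3 := mul_le_norm_ntsBase (β := β) hθ hg' hδ hu h
    have h4 : κ * u ≤ ‖ntsBase α θ β (vline δ u)‖ := by
      refine le_trans ?_ h3
      refine mul_le_mul_of_nonneg_right (min_le_min le_rfl ?_) hu.le
      gcongr
    have h5 := Real.rpow_le_rpow_of_nonpos (mul_pos hκ0 hu) h4 hp1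
    rw [Real.mul_rpow hκ0.le hu.le] at h5
    nlinarith [mul_pos hk2 hup]
  · have h4 : g₀ / (2 * θ) ≤ ‖ntsBase α θ β (vline δ u)‖ := by
      refine le_trans ?_ (Complex.re_le_norm _)
      rw [ntsBase_vline_re]
      have : g₀ / (2 * θ) ≤ gammaSq α θ β * (u ^ 2 / (2 * θ)) := by
        rw [div_eq_mul_one_div]
        gcongr
        nlinarith
      linarith
    have h5 := Real.rpow_le_rpow_of_nonpos (by positivity) h4 hp1
    nlinarith [mul_pos hk2 hup, mul_pos hk1 hup]

theorem norm_vline_sq_le (hδ : 0 < δ) {δ₁ : ℝ} (hδ₁ : δ ≤ δ₁) :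
    ‖vline δ u‖ ^ 2 ≤ (1 + δ₁) ^ 2 * (1 + u ^ 2) := by
  rw [norm_vline_sq]
  have h1 : δ ^ 2 ≤ (1 + δ₁) ^ 2 := pow_le_pow_left₀ hδ.le (by linarith) 2
  have h2 : 1 * u ^ 2 ≤ (1 + δ₁) ^ 2 * u ^ 2 :=
    mul_le_mul_of_nonneg_right (one_le_pow₀ (by linarith)) (sq_nonneg u)
  linarith

theorem norm_vline_le (hδ : 0 < δ) {δ₁ : ℝ} (hδ₁ : δ ≤ δ₁) :
    ‖vline δ u‖ ≤ (1 + δ₁) ^ 2 * (1 + u ^ 2) := by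
  rcases le_or_gt ‖vline δ u‖ 1 with h | h
  · refine h.trans (one_le_mul_of_one_le_of_one_le (one_le_pow₀ (by linarith)) ?_)
    linarith [sq_nonneg u]
  · exact (le_self_pow₀ h.le two_ne_zero).trans (norm_vline_sq_le hδ hδ₁)

theorem exists_fourierBound (hα : α ∈ Ioo (0 : ℝ) 2) (hθ : 0 < θ) {δ₁ β₁ g₀ a₁ : ℝ}
    (hg₀ : 0 < g₀) : ∃ C c : ℝ, 0 < C ∧ 0 < c ∧ ∀ δ β a u : ℝ, 0 < δ → δ ≤ δ₁ → |β| ≤ β₁ →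
      g₀ ≤ gammaSq α θ β → 0 ≤ ntsBaseReal α θ β δ → |a| ≤ a₁ → 0 < u →
      ‖Complex.exp (vline δ u * a) * ntsMGF α θ β (vline δ u)‖
        * (1 + ‖vline δ u‖ + ‖ntsLogDeriv α θ β (vline δ u)‖) ≤ C * fourierBound α c u := by
  set p := α / 2 with hp
  have hp0 : 0 < p := half_pos hα.1
  have hp1 : p - 1 ≤ 0 := by linarith [hα.2]
  set D := |β₁| * ((2 - α) / (2 * θ)) with hD
  set E := (1 + |δ₁|) ^ 2 with hE
  set K := |min (1 / 2) (1 / (2 * δ₁))| ^ (p - 1) + (g₀ / (2 * θ)) ^ (p - 1) with hK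
  set c := 2 * θ / α * (Real.cos (Real.pi / 2 * (α / 2)) * (g₀ / (2 * θ)) ^ (α / 2)) with hc
  have hcos : 0 < Real.cos (Real.pi / 2 * (α / 2)) :=
    Real.cos_pos_of_mem_Ioo ⟨by nlinarith [Real.pi_pos, hα.1], by nlinarith [Real.pi_pos, hα.2]⟩
  have h2α : 0 < 2 - α := by linarith [hα.2]
  have hc0 : 0 < c := by
    have := hα.1
    positivity
  have hK0 : 0 ≤ K := by positivity
  have hD0 : 0 ≤ D := by positivity
  refine ⟨Real.exp (|δ₁| * |a₁|) * Real.exp (|δ₁| * |β₁| + 2 * θ / α)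
    * (1 + E * (2 + K * (1 + D))), c, by positivity, hc0, ?_⟩
  intro δ β a u hδ hδ₁ hβ hg hA ha hu
  have hδ1 : 0 < δ₁ := hδ.trans_le hδ₁
  have hg' : 0 < gammaSq α θ β := hg₀.trans_le hg
  have hu2 : 0 < u ^ 2 := by positivity
  have hup : 0 < u ^ (p - 1) := Real.rpow_pos_of_pos hu _
  -- the exponential factors
  have h1 : ‖Complex.exp (vline δ u * a) * ntsMGF α θ β (vline δ u)‖
      ≤ Real.exp (|δ₁| * |a₁|) * (Real.exp (|δ₁| * |β₁| + 2 * θ / α)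
        * Real.exp (-c * u ^ α)) := by
    rw [norm_mul]
    refine mul_le_mul ?_ ((norm_ntsMGF_le hα hθ hg₀ hg hA hu).trans ?_) (norm_nonneg _)
      (Real.exp_pos _).le
    · rw [Complex.norm_exp, Real.exp_le_exp, Complex.re_mul_ofReal, vline_re]
      refine (le_abs_self _).trans ?_
      rw [abs_mul]
      exact mul_le_mul (abs_le_abs_of_nonneg hδ.le hδ₁) (ha.trans (le_abs_self _)) (abs_nonneg _)
        (abs_nonneg _)
    · rw [← hc]
      refine mul_le_mul_of_nonneg_right (Real.exp_le_exp.2 (add_le_add_left ?_ _))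
        (Real.exp_pos _).le
      refine (le_abs_self _).trans ?_
      rw [abs_mul]
      exact mul_le_mul (abs_le_abs_of_nonneg hδ.le hδ₁) (hβ.trans (le_abs_self _)) (abs_nonneg _)
        (abs_nonneg _)
  -- the polynomial factors
  have hs2 : ‖vline δ u‖ ^ 2 ≤ E * (1 + u ^ 2) := by
    rw [hE, abs_of_pos hδ1]
    exact norm_vline_sq_le hδ hδ₁
  have hs1 : ‖vline δ u‖ ≤ E * (1 + u ^ 2) := by
    rw [hE, abs_of_pos hδ1]
    exact norm_vline_le hδ hδ₁
  have hb : ‖ntsBase α θ β (vline δ u)‖ ^ (p - 1) ≤ K * (1 + u ^ (p - 1)) :=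
    norm_ntsBase_rpow_le hα hθ hg₀ hg hδ hδ₁ hA hu
  have hψ : ‖ntsLogDeriv α θ β (vline δ u)‖
      ≤ E * (1 + u ^ 2) + K * (1 + u ^ (p - 1)) * ((1 + D) * (E * (1 + u ^ 2))) := by
    rw [ntsLogDeriv]
    refine (norm_sub_le _ _).trans (add_le_add hs1 ?_)
    rw [norm_mul]
    have hne : ntsBase α θ β (vline δ u) ≠ 0 := fun h => by
      have := ntsBase_vline_re_pos hθ hg' hA hu.ne'
      simp [h] at this
    refine mul_le_mul ?_ ?_ (norm_nonneg _) (by positivity)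
    · refine (Complex.norm_cpow_le _ _).trans ?_
      simpa using hb
    · refine (norm_add_le _ _).trans ?_
      rw [norm_mul, Complex.norm_real, norm_pow, Real.norm_eq_abs, abs_mul,
        abs_of_pos (div_pos h2α (by positivity : 0 < 2 * θ)), add_mul, one_mul]
      refine add_le_add hs1 (mul_le_mul ?_ hs2 (by positivity) hD0)
      exact mul_le_mul_of_nonneg_right (hβ.trans (le_abs_self _)) (by positivity)
  have h3 : 1 + ‖vline δ u‖ + ‖ntsLogDeriv α θ β (vline δ u)‖
      ≤ (1 + E * (2 + K * (1 + D))) * ((1 + u ^ 2) * (1 + u ^ (p - 1))) := by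
    have t1 : 1 ≤ (1 + u ^ 2) * (1 + u ^ (p - 1)) := by nlinarith
    have t2 : E * (1 + u ^ 2) ≤ E * ((1 + u ^ 2) * (1 + u ^ (p - 1))) := by
      refine mul_le_mul_of_nonneg_left ?_ (by positivity)
      nlinarith
    have t3 : K * (1 + u ^ (p - 1)) * ((1 + D) * (E * (1 + u ^ 2)))
        = E * (K * (1 + D)) * ((1 + u ^ 2) * (1 + u ^ (p - 1))) := by ring
    rw [t3] at hψ
    linarith
  refine (mul_le_mul h1 h3 (by positivity) (by positivity)).trans_eq ?_
  rw [fourierBound]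
  ring

end Bounds

/-! ### Fourier representation of the expected shortfall -/

section Kernel

variable {δ : ℝ}

theorem integrableOn_mul_exp (hδ : 0 < δ) (u : ℝ) :
    IntegrableOn (fun t : ℝ => (t : ℂ) * Complex.exp (-(vline δ u * t))) (Ioi 0) := by
  have h := integrableOn_rpow_mul_exp_neg_mul_rpow (s := 1) (p := 1) (b := δ) (by norm_num)
    one_pos hδ
  refine Integrable.mono' h (Continuous.aestronglyMeasurable (by fun_prop)) ?_
  filter_upwards [ae_restrict_mem measurableSet_Ioi] with t ht
  have ht : 0 < t := ht
  rw [norm_mul, Complex.norm_exp, Complex.norm_real, Real.norm_eq_abs, abs_of_pos ht]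
  simp

theorem integral_mul_exp (hδ : 0 < δ) (u : ℝ) :
    ∫ t : ℝ in Ioi 0, (t : ℂ) * Complex.exp (-(vline δ u * t)) = 1 / vline δ u ^ 2 := by
  set s := vline δ u with hs
  have hs0 : s ≠ 0 := vline_ne_zero hδ
  have hderiv : ∀ t : ℝ, HasDerivAt
      (fun t : ℝ => -((t : ℂ) / s + 1 / s ^ 2) * Complex.exp (-(s * t)))
      ((t : ℂ) * Complex.exp (-(s * t))) t := by
    intro t
    have h0 : HasDerivAt (fun t : ℝ => (t : ℂ)) 1 t := Complex.ofRealCLM.hasDerivAt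
    have h1 : HasDerivAt (fun t : ℝ => -((t : ℂ) / s + 1 / s ^ 2)) (-(1 / s)) t :=
      ((h0.div_const s).add_const _).fun_neg
    have h2 : HasDerivAt (fun t : ℝ => Complex.exp (-(s * t)))
        (Complex.exp (-(s * t)) * -(s * 1)) t := ((h0.const_mul s).fun_neg).cexp
    refine (h1.fun_mul h2).congr_deriv ?_
    field_simp
    ring
  have hlim : Tendsto (fun t : ℝ => -((t : ℂ) / s + 1 / s ^ 2) * Complex.exp (-(s * t)))
      atTop (𝓝 0) := by
    have h1 : Tendsto (fun t : ℝ => ‖s‖⁻¹ * (t ^ (1 : ℝ) * Real.exp (-δ * t))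
        + (‖s‖ ^ 2)⁻¹ * (t ^ (0 : ℝ) * Real.exp (-δ * t))) atTop (𝓝 (‖s‖⁻¹ * 0 + (‖s‖ ^ 2)⁻¹ * 0)) :=
      ((tendsto_rpow_mul_exp_neg_mul_atTop_nhds_zero 1 δ hδ).const_mul _).add
        ((tendsto_rpow_mul_exp_neg_mul_atTop_nhds_zero 0 δ hδ).const_mul _)
    rw [mul_zero, mul_zero, add_zero] at h1
    refine squeeze_zero_norm' ?_ h1
    filter_upwards [eventually_gt_atTop 0] with t ht
    have hn : ‖Complex.exp (-(s * t))‖ = Real.exp (-δ * t) := by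
      rw [Complex.norm_exp, hs]
      simp
    rw [norm_mul, norm_neg, hn, Real.rpow_one, Real.rpow_zero, ← mul_assoc, ← mul_assoc, ← add_mul]
    refine mul_le_mul_of_nonneg_right ((norm_add_le _ _).trans_eq ?_) (Real.exp_pos _).le
    rw [norm_div, norm_div, Complex.norm_real, Real.norm_eq_abs, abs_of_pos ht, norm_one, norm_pow]
    ring
  rw [integral_Ioi_of_hasDerivAt_of_tendsto (hderiv 0).continuousAt.continuousWithinAt
    (fun t _ => hderiv t) (integrableOn_mul_exp hδ u) hlim]
  simp

theorem integrable_one_div_vline_sq (hδ : 0 < δ) :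
    Integrable fun u : ℝ => 1 / vline δ u ^ 2 := by
  have h : Integrable fun u : ℝ => (δ ^ 2)⁻¹ * (1 + (δ⁻¹ * u) ^ 2)⁻¹ :=
    (integrable_inv_one_add_sq.comp_mul_left' (inv_ne_zero hδ.ne')).const_mul _
  refine h.mono' ?_ (Eventually.of_forall fun u => ?_)
  · exact ((continuous_const.div ((continuous_vline δ).pow 2)
      fun u => pow_ne_zero 2 (vline_ne_zero hδ))).aestronglyMeasurable
  · rw [norm_div, norm_one, norm_pow, norm_vline_sq]
    refine le_of_eq ?_
    field_simp

theorem integrable_exp_div_vline_sq (hδ : 0 < δ) (y : ℝ) :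
    Integrable fun u : ℝ => Complex.exp (vline δ u * y) / vline δ u ^ 2 := by
  have hc : Continuous fun u : ℝ => Complex.exp (vline δ u * y) := by
    have := continuous_vline δ
    fun_prop
  have := (integrable_one_div_vline_sq hδ).bdd_mul (c := Real.exp (δ * y)) hc.aestronglyMeasurable
    (Eventually.of_forall fun u => by simp [Complex.norm_exp])
  refine this.congr (Eventually.of_forall fun u => ?_)
  simp only
  ring

open FourierTransform in
/-- The Fourier (or inverse Laplace) representation of the positive part. -/
theorem integral_exp_div_vline_sq (hδ : 0 < δ) (y : ℝ) :
    ∫ u : ℝ, Complex.exp (vline δ u * y) / vline δ u ^ 2 = 2 * Real.pi * max y 0 := by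
  set g : ℝ → ℂ := fun t => (max t 0 : ℝ) * Complex.exp (-(δ * t : ℝ)) with hg
  have hgc : Continuous g := by
    rw [hg]
    fun_prop
  have hind : ∀ u : ℝ, (fun t : ℝ => Complex.exp (-(u * t * Complex.I)) * g t)
      = (Ioi 0).indicator fun t : ℝ => (t : ℂ) * Complex.exp (-(vline δ u * t)) := by
    intro u
    ext t
    rw [indicator_apply]
    split_ifs with ht
    · rw [hg]
      simp only
      rw [max_eq_left (le_of_lt ht), mul_left_comm, ← Complex.exp_add, vline_eq]
      congr 2
      push_cast
      ring
    · simp [hg, max_eq_right (not_lt.1 (mem_Ioi.not.1 ht))]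
  have hgi : Integrable g := by
    have h := hind 0
    simp only [Complex.ofReal_zero, zero_mul, neg_zero, Complex.exp_zero, one_mul] at h
    have h2 := (integrableOn_mul_exp hδ 0).integrable_indicator measurableSet_Ioi
    rw [← h] at h2
    exact h2
  have hF : 𝓕 g = fun ξ => 1 / vline δ (2 * Real.pi * ξ) ^ 2 := by
    ext ξ
    rw [Real.fourier_real_eq_integral_exp_smul, ← integral_mul_exp hδ,
      ← integral_indicator measurableSet_Ioi, ← hind]
    refine integral_congr_ae (Eventually.of_forall fun t => ?_)
    simp only [smul_eq_mul]
    congr 2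
    push_cast
    ring
  have hpi : (2 * Real.pi : ℝ) ≠ 0 := by positivity
  have hFi : Integrable (𝓕 g) := by
    rw [hF]
    exact (integrable_one_div_vline_sq hδ).comp_mul_left' hpi
  have hinv := congrFun (hgc.fourierInv_fourier_eq hgi hFi) y
  rw [Real.fourierInv_eq', hF] at hinv
  have h1 : ∫ ξ : ℝ, (fun u : ℝ => Complex.exp (u * y * Complex.I) * (1 / vline δ u ^ 2))
      (2 * Real.pi * ξ) = g y := by
    rw [← hinv]
    refine integral_congr_ae (Eventually.of_forall fun t => ?_)
    simp only [smul_eq_mul]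
    congr 2
    simp
    ring
  rw [Measure.integral_comp_mul_left (fun u : ℝ => Complex.exp (u * y * Complex.I)
    * (1 / vline δ u ^ 2)), abs_of_pos (by positivity)] at h1
  have h2 : ∫ u : ℝ, Complex.exp (u * y * Complex.I) * (1 / vline δ u ^ 2)
      = 2 * Real.pi * g y := by
    rw [inv_smul_eq_iff₀ hpi] at h1
    rw [h1, Complex.real_smul]
    push_cast
    ring
  have h3 : ∀ u : ℝ, Complex.exp (vline δ u * y) / vline δ u ^ 2
      = Complex.exp (δ * y : ℝ) * (Complex.exp (u * y * Complex.I) * (1 / vline δ u ^ 2)) := by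
    intro u
    rw [← mul_assoc, ← Complex.exp_add, mul_one_div, vline_eq]
    congr 2
    push_cast
    ring
  simp only [h3]
  rw [integral_const_mul, h2, hg]
  simp only
  have h4 : Complex.exp (δ * y : ℝ) * Complex.exp (-(δ * y : ℝ)) = 1 := by
    rw [← Complex.exp_add, add_neg_cancel, Complex.exp_zero]
  linear_combination (2 * Real.pi * (max y 0 : ℝ)) * h4

theorem re_integral_Ioi_exp_div_vline_sq (hδ : 0 < δ) (y : ℝ) :
    (∫ u in Ioi (0 : ℝ), Complex.exp (vline δ u * y) / vline δ u ^ 2).re = Real.pi * max y 0 := by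
  have hi := integrable_exp_div_vline_sq hδ y
  have h1 : (∫ u in Ioi (0 : ℝ), Complex.exp (vline δ u * y) / vline δ u ^ 2).re
      = ∫ u in Ioi (0 : ℝ), (Complex.exp (vline δ u * y) / vline δ u ^ 2).re :=
    (integral_re hi.integrableOn).symm
  have h2 : (∫ u, Complex.exp (vline δ u * y) / vline δ u ^ 2).re
      = ∫ u, (Complex.exp (vline δ u * y) / vline δ u ^ 2).re := (integral_re hi).symm
  have hconj : ∀ u, (Complex.exp (vline δ (-u) * y) / vline δ (-u) ^ 2).re
      = (Complex.exp (vline δ u * y) / vline δ u ^ 2).re := by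
    intro u
    have hv : vline δ (-u) = (starRingEnd ℂ) (vline δ u) := by
      apply Complex.ext <;> simp
    rw [hv, ← Complex.conj_re (Complex.exp (vline δ u * y) / vline δ u ^ 2), map_div₀, map_pow,
      ← Complex.exp_conj, map_mul, Complex.conj_ofReal]
  have h3 := integral_comp_abs (f := fun u => (Complex.exp (vline δ u * y) / vline δ u ^ 2).re)
  have h4 : (fun u : ℝ => (Complex.exp (vline δ |u| * y) / vline δ |u| ^ 2).re)
      = fun u : ℝ => (Complex.exp (vline δ u * y) / vline δ u ^ 2).re := by
    ext u
    rcases abs_choice u with h | h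
    · rw [h]
    · rw [h, hconj]
  rw [h4, ← h2, ← h1, integral_exp_div_vline_sq hδ] at h3
  have h5 : (2 * Real.pi * ((max y 0 : ℝ) : ℂ)).re = 2 * Real.pi * max y 0 := by
    rw [Complex.re_mul_ofReal]
    simp
  rw [h5] at h3
  linarith

/-- The expected shortfall below `a` of a law with finite exponential moment, as a Fourier
integral of its moment generating function. -/
theorem integral_max_sub {m : Measure ℝ} [IsProbabilityMeasure m] (hδ : 0 < δ)
    (hm : -δ ∈ integrableExpSet id m) (a : ℝ) :
    ∫ x, max (a - x) 0 ∂m = 1 / Real.pi * (∫ u in Ioi (0 : ℝ),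
      Complex.exp (vline δ u * a) * complexMGF id m (-vline δ u) / vline δ u ^ 2).re := by
  have hexp : Integrable (fun x : ℝ => Real.exp (-δ * x)) m := hm
  set f : ℝ → ℝ → ℂ := fun x u => Complex.exp (vline δ u * (a - x : ℝ)) / vline δ u ^ 2 with hf
  have hfm : AEStronglyMeasurable (Function.uncurry f) (m.prod (volume.restrict (Ioi 0))) := by
    have := (continuous_vline δ).comp (continuous_snd (X := ℝ) (Y := ℝ))
    refine Continuous.aestronglyMeasurable (Continuous.div ?_ (this.pow 2)
      fun p => pow_ne_zero 2 (vline_ne_zero hδ))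
    refine Complex.continuous_exp.comp (this.mul ?_)
    fun_prop
  have hfi : Integrable (Function.uncurry f) (m.prod (volume.restrict (Ioi 0))) := by
    have h1 := (hexp.const_mul (Real.exp (δ * a))).mul_prod
      (ν := volume.restrict (Ioi 0)) (integrable_one_div_vline_sq hδ).norm.integrableOn
    refine h1.mono' hfm (Eventually.of_forall fun p => le_of_eq ?_)
    simp only [Function.uncurry, hf]
    rw [norm_div, norm_div, norm_one, Complex.norm_exp, Complex.re_mul_ofReal, vline_re,
      ← Real.exp_add]
    rw [div_eq_mul_one_div]
    ring_nf
  have h1 : ∀ x, max (a - x) 0 = 1 / Real.pi * (∫ u in Ioi (0 : ℝ), f x u).re := fun x => by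
    rw [re_integral_Ioi_exp_div_vline_sq hδ]
    field_simp
  simp only [h1]
  rw [integral_const_mul]
  congr 1
  have h2 : ∫ x, (∫ u in Ioi (0 : ℝ), f x u).re ∂m = (∫ x, (∫ u in Ioi (0 : ℝ), f x u) ∂m).re :=
    integral_re hfi.integral_prod_left
  rw [h2, integral_integral_swap hfi]
  congr 1
  refine integral_congr_ae (Eventually.of_forall fun u => ?_)
  simp only [hf, complexMGF]
  rw [integral_div, ← integral_const_mul]
  congr 1
  refine integral_congr_ae (Eventually.of_forall fun x => ?_)
  simp only [id]
  rw [← Complex.exp_add]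
  congr 1
  push_cast
  ring

/-- The derivative of the expected shortfall in the threshold is the distribution function. -/
theorem hasDerivAt_integral_max_sub_eq_cdf {m : Measure ℝ} [IsProbabilityMeasure m]
    (hm : Integrable id m) {a D : ℝ}
    (hD : HasDerivAt (fun a => ∫ x, max (a - x) 0 ∂m) D a) : D = cdf m a := by
  set K : ℝ → ℝ := fun a => ∫ x, max (a - x) 0 ∂m with hK
  have hint : ∀ a : ℝ, Integrable (fun x => max (a - x) 0) m := fun a =>
    ((integrable_const a).sub hm).pos_part
  have hind : ∀ a h : ℝ, ∫ x, (Iic a).indicator (fun _ => h) x ∂m = h * cdf m a := fun a h => by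
    rw [integral_indicator_const h measurableSet_Iic, cdf_eq_real, smul_eq_mul, mul_comm]
  have hinti : ∀ a h : ℝ, Integrable ((Iic a).indicator fun _ => h) m := fun a h =>
    (integrable_const h).indicator measurableSet_Iic
  have hlo : ∀ h > 0, h * cdf m a ≤ K (a + h) - K a := fun h hh => by
    rw [hK, ← hind, ← integral_sub (hint _) (hint _)]
    refine integral_mono (hinti _ _) ((hint _).sub (hint _)) fun x => ?_
    simp only [indicator_apply, mem_Iic]
    split_ifs with hx
    · rw [max_eq_left (by linarith), max_eq_left (by linarith)]
      linarith
    · rw [sub_nonneg]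
      exact max_le_max (by linarith) le_rfl
  have hhi : ∀ h > 0, K (a + h) - K a ≤ h * cdf m (a + h) := fun h hh => by
    rw [hK, ← hind, ← integral_sub (hint _) (hint _)]
    refine integral_mono ((hint _).sub (hint _)) (hinti _ _) fun x => ?_
    simp only [indicator_apply, mem_Iic]
    split_ifs with hx
    · rw [max_eq_left (by linarith : 0 ≤ a + h - x)]
      linarith [le_max_left (a - x) 0]
    · rw [max_eq_right (by linarith), sub_nonpos]
      exact le_max_right _ _
  have hs := (hasDerivAt_iff_tendsto_slope_zero.1 hD).mono_left
    (nhdsWithin_mono 0 (t := {0}ᶜ) (s := Ioi 0) fun x hx => ne_of_gt hx)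
  refine le_antisymm ?_ ?_
  · have hr : Tendsto (fun h => cdf m (a + h)) (𝓝[>] 0) (𝓝 (cdf m a)) := by
      have h1 := ((cdf m).right_continuous a).tendsto
      refine h1.comp (tendsto_nhdsWithin_iff.2 ⟨?_, ?_⟩)
      · refine Tendsto.mono_left ?_ nhdsWithin_le_nhds
        exact Continuous.tendsto' (by fun_prop) _ _ (by simp)
      · filter_upwards [self_mem_nhdsWithin] with h hh
        have : (0 : ℝ) < h := hh
        simp [this.le]
    refine le_of_tendsto_of_tendsto hs hr ?_
    filter_upwards [self_mem_nhdsWithin] with h hh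
    have hh : 0 < h := hh
    rw [smul_eq_mul, inv_mul_le_iff₀ hh]
    exact hhi h hh
  · refine ge_of_tendsto hs ?_
    filter_upwards [self_mem_nhdsWithin] with h hh
    have hh : 0 < h := hh
    rw [smul_eq_mul, le_inv_mul_iff₀ hh]
    exact hlo h hh

end Kernel

/-! ### Differentiation of the Fourier integrals -/

section Differentiation

variable {α θ β δ : ℝ}

theorem hasDerivAt_gammaSq (α θ β : ℝ) :
    HasDerivAt (gammaSq α θ) (-(2 * β * ((2 - α) / (2 * θ)))) β := by
  have := (((hasDerivAt_id' β).fun_pow 2).mul_const ((2 - α) / (2 * θ))).const_sub 1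
  exact this.congr_deriv (by simp)

theorem continuous_gammaSq (α θ : ℝ) : Continuous (gammaSq α θ) := by
  unfold gammaSq
  fun_prop

theorem continuous_ntsBaseReal_left (α θ δ : ℝ) : Continuous fun β => ntsBaseReal α θ β δ := by
  have := continuous_gammaSq α θ
  unfold ntsBaseReal
  fun_prop

theorem hasDerivAt_ntsMGF (hα : α ≠ 0) (hθ : 0 < θ) {s : ℂ} (hs : 0 < (ntsBase α θ β s).re) :
    HasDerivAt (fun β : ℝ => ntsMGF α θ β s) (ntsMGF α θ β s * ntsLogDeriv α θ β s) β := by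
  have hθ' : (θ : ℂ) ≠ 0 := by exact_mod_cast hθ.ne'
  have hα' : (α : ℂ) ≠ 0 := by exact_mod_cast hα
  have h0 : HasDerivAt (fun β : ℝ => (β : ℂ)) 1 β := Complex.ofRealCLM.hasDerivAt
  have hg : HasDerivAt (fun β : ℝ => (gammaSq α θ β : ℂ))
      ((-(2 * β * ((2 - α) / (2 * θ))) : ℝ) : ℂ) β := (hasDerivAt_gammaSq α θ β).ofReal_comp
  have hb : HasDerivAt (fun β : ℝ => ntsBase α θ β s)
      (s * 1 / θ - ((-(2 * β * ((2 - α) / (2 * θ))) : ℝ) : ℂ) * (s ^ 2 / (2 * θ))) β :=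
    ((((h0.const_mul s).div_const (θ : ℂ)).const_add 1).fun_sub (hg.mul_const _))
  have hz : HasDerivAt (fun z : ℂ => z ^ ((α / 2 : ℝ) : ℂ)) _ (ntsBase α θ β s) :=
    (hasDerivAt_id' _).cpow_const (Or.inl hs)
  have hc := HasDerivAt.comp (h₂ := fun z : ℂ => z ^ ((α / 2 : ℝ) : ℂ))
    (h := fun β : ℝ => ntsBase α θ β s) β hz hb
  have he := ((h0.const_mul s).fun_sub ((hc.sub_const 1).const_mul ((2 * θ / α : ℝ) : ℂ))).cexp
  refine he.congr_deriv ?_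
  have e : ((α / 2 : ℝ) : ℂ) - 1 = ((α / 2 - 1 : ℝ) : ℂ) := by push_cast; ring
  rw [e, ntsMGF, ntsLogDeriv]
  congr 1
  push_cast
  field_simp
  ring

theorem measurable_ntsBase (α θ β δ : ℝ) : Measurable fun u => ntsBase α θ β (vline δ u) := by
  have := (continuous_vline δ).measurable
  unfold ntsBase
  fun_prop

theorem measurable_ntsMGF (α θ β δ : ℝ) : Measurable fun u => ntsMGF α θ β (vline δ u) := by
  have h1 := (continuous_vline δ).measurable
  have h2 := (measurable_ntsBase α θ β δ).pow_const ((α / 2 : ℝ) : ℂ)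
  unfold ntsMGF
  fun_prop

theorem measurable_ntsLogDeriv (α θ β δ : ℝ) :
    Measurable fun u => ntsLogDeriv α θ β (vline δ u) := by
  have h1 := (continuous_vline δ).measurable
  have h2 := (measurable_ntsBase α θ β δ).pow_const ((α / 2 - 1 : ℝ) : ℂ)
  unfold ntsLogDeriv
  fun_prop

/-- The Fourier integrand at threshold `p.1` and parameter `p.2`. The power `k = 2` yields the
expected shortfall and `k = 1` the distribution function. -/
noncomputable def fourierTerm (α θ : ℝ) (k : ℕ) (δ : ℝ) (p : ℝ × ℝ) (u : ℝ) : ℂ :=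
  Complex.exp (vline δ u * p.1) * ntsMGF α θ p.2 (vline δ u) / vline δ u ^ k

theorem measurable_fourierTerm (α θ : ℝ) (k : ℕ) (δ : ℝ) (p : ℝ × ℝ) :
    Measurable (fourierTerm α θ k δ p) := by
  have h1 := (continuous_vline δ).measurable
  have h2 := measurable_ntsMGF α θ p.2 δ
  unfold fourierTerm
  fun_prop

/-- The Fréchet derivative of `fourierTerm` in its two real parameters. -/
noncomputable def fourierTermDeriv (α θ : ℝ) (k : ℕ) (δ : ℝ) (p : ℝ × ℝ) (u : ℝ) :
    ℝ × ℝ →L[ℝ] ℂ :=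
  (ContinuousLinearMap.fst ℝ ℝ ℝ).smulRight (fourierTerm α θ k δ p u * vline δ u)
    + (ContinuousLinearMap.snd ℝ ℝ ℝ).smulRight
      (fourierTerm α θ k δ p u * ntsLogDeriv α θ p.2 (vline δ u))

theorem fourierTermDeriv_apply (k : ℕ) (p v : ℝ × ℝ) (u : ℝ) :
    fourierTermDeriv α θ k δ p u v = fourierTerm α θ k δ p u
      * (vline δ u * v.1 + ntsLogDeriv α θ p.2 (vline δ u) * v.2) := by
  simp only [fourierTermDeriv, _root_.add_apply,
    ContinuousLinearMap.smulRight_apply, ContinuousLinearMap.coe_fst',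
    ContinuousLinearMap.coe_snd', Complex.real_smul]
  ring

theorem hasFDerivAt_fourierTerm (hα : α ≠ 0) (hθ : 0 < θ) (k : ℕ) {p : ℝ × ℝ} {u : ℝ}
    (hs : 0 < (ntsBase α θ p.2 (vline δ u)).re) :
    HasFDerivAt (fun p => fourierTerm α θ k δ p u) (fourierTermDeriv α θ k δ p u) p := by
  have h0 : HasDerivAt (fun a : ℝ => (a : ℂ)) 1 p.1 := Complex.ofRealCLM.hasDerivAt
  have h1 : HasFDerivAt (fun p : ℝ × ℝ => Complex.exp (vline δ u * p.1)) _ p :=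
    ((h0.const_mul (vline δ u)).cexp.hasFDerivAt).comp p hasFDerivAt_fst
  have h2 : HasFDerivAt (fun p : ℝ × ℝ => ntsMGF α θ p.2 (vline δ u)) _ p :=
    ((hasDerivAt_ntsMGF hα hθ hs).hasFDerivAt).comp p hasFDerivAt_snd
  have h3 := (h1.fun_mul h2).mul_const ((vline δ u ^ k)⁻¹)
  simp only [← div_eq_mul_inv] at h3
  refine h3.congr_fderiv ?_
  ext <;> simp [fourierTermDeriv_apply, fourierTerm] <;> ring

theorem norm_fourierTerm_mul_le {k : ℕ} (hδ : 0 < δ) (p : ℝ × ℝ) (u : ℝ) {x D : ℝ}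
    (hx : ‖Complex.exp (vline δ u * p.1) * ntsMGF α θ p.2 (vline δ u)‖ * x ≤ D) (hx0 : 0 ≤ x) :
    ‖fourierTerm α θ k δ p u‖ * x ≤ (δ ^ k)⁻¹ * D := by
  rw [fourierTerm, norm_div, norm_pow, div_eq_inv_mul, mul_assoc]
  refine mul_le_mul ?_ hx (by positivity) (by positivity)
  exact inv_anti₀ (pow_pos hδ k) (pow_le_pow_left₀ hδ.le le_norm_vline k)

theorem norm_fourierTermDeriv_le (k : ℕ) (p : ℝ × ℝ) (u : ℝ) :
    ‖fourierTermDeriv α θ k δ p u‖ ≤ ‖fourierTerm α θ k δ p u‖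
      * (1 + ‖vline δ u‖ + ‖ntsLogDeriv α θ p.2 (vline δ u)‖) := by
  refine (norm_add_le _ _).trans ?_
  rw [ContinuousLinearMap.norm_smulRight_apply, ContinuousLinearMap.norm_smulRight_apply,
    norm_mul, norm_mul]
  have h1 := ContinuousLinearMap.norm_fst_le ℝ ℝ ℝ
  have h2 := ContinuousLinearMap.norm_snd_le ℝ ℝ ℝ
  have h3 := mul_le_of_le_one_left (mul_nonneg (norm_nonneg (fourierTerm α θ k δ p u))
    (norm_nonneg (vline δ u))) h1
  have h4 := mul_le_of_le_one_left (mul_nonneg (norm_nonneg (fourierTerm α θ k δ p u))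
    (norm_nonneg (ntsLogDeriv α θ p.2 (vline δ u)))) h2
  nlinarith [norm_nonneg (fourierTerm α θ k δ p u)]

theorem aestronglyMeasurable_fourierTermDeriv (k : ℕ) (p : ℝ × ℝ) (ν : Measure ℝ) :
    AEStronglyMeasurable (fourierTermDeriv α θ k δ p) ν := by
  have h1 := measurable_fourierTerm α θ k δ p
  have h2 := (continuous_vline δ).measurable
  have h3 := measurable_ntsLogDeriv α θ p.2 δ
  refine AEStronglyMeasurable.add ?_ ?_
  · exact (ContinuousLinearMap.smulRightL ℝ (ℝ × ℝ) ℂ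
      (ContinuousLinearMap.fst ℝ ℝ ℝ)).continuous.comp_aestronglyMeasurable
        (h1.mul h2).aestronglyMeasurable
  · exact (ContinuousLinearMap.smulRightL ℝ (ℝ × ℝ) ℂ
      (ContinuousLinearMap.snd ℝ ℝ ℝ)).continuous.comp_aestronglyMeasurable
        (h1.mul h3).aestronglyMeasurable

/-- All Fourier integrals of this section converge absolutely, including those on the boundary
line of the region of convergence, where `ntsBaseReal` vanishes. -/
theorem integrableOn_fourierTermDeriv (hα : α ∈ Ioo (0 : ℝ) 2) (hθ : 0 < θ) (k : ℕ) (hδ : 0 < δ)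
    {p : ℝ × ℝ} (hg : 0 < gammaSq α θ p.2) (hA : 0 ≤ ntsBaseReal α θ p.2 δ) :
    IntegrableOn (fourierTermDeriv α θ k δ p) (Ioi 0) := by
  obtain ⟨C, c, -, hc, hbound⟩ := exists_fourierBound hα hθ (δ₁ := δ) (β₁ := |p.2|) (a₁ := |p.1|) hg
  refine (((integrableOn_fourierBound hα hc).const_mul C).const_mul (δ ^ k)⁻¹).mono'
    (aestronglyMeasurable_fourierTermDeriv k p _) ?_
  filter_upwards [ae_restrict_mem measurableSet_Ioi] with u hu
  exact (norm_fourierTermDeriv_le k p u).trans (norm_fourierTerm_mul_le hδ p u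
    (hbound δ p.2 p.1 u hδ le_rfl le_rfl le_rfl hA le_rfl hu) (by positivity))

theorem integrableOn_fourierTerm (hα : α ∈ Ioo (0 : ℝ) 2) (hθ : 0 < θ) (k : ℕ) (hδ : 0 < δ)
    {p : ℝ × ℝ} (hg : 0 < gammaSq α θ p.2) (hA : 0 ≤ ntsBaseReal α θ p.2 δ) :
    IntegrableOn (fourierTerm α θ k δ p) (Ioi 0) := by
  obtain ⟨C, c, -, hc, hbound⟩ := exists_fourierBound hα hθ (δ₁ := δ) (β₁ := |p.2|) (a₁ := |p.1|) hg
  refine (((integrableOn_fourierBound hα hc).const_mul C).const_mul (δ ^ k)⁻¹).mono'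
    (measurable_fourierTerm α θ k δ p).aestronglyMeasurable ?_
  filter_upwards [ae_restrict_mem measurableSet_Ioi] with u hu
  refine le_trans ?_ (norm_fourierTerm_mul_le hδ p u
    (hbound δ p.2 p.1 u hδ le_rfl le_rfl le_rfl hA le_rfl hu) (by positivity))
  refine le_mul_of_one_le_right (norm_nonneg _) ?_
  linarith [norm_nonneg (vline δ u), norm_nonneg (ntsLogDeriv α θ p.2 (vline δ u))]

theorem hasFDerivAt_integral_fourierTerm (hα : α ∈ Ioo (0 : ℝ) 2) (hθ : 0 < θ) (k : ℕ)
    (hδ : 0 < δ) {p : ℝ × ℝ} (hg : 0 < gammaSq α θ p.2) (hA : 0 < ntsBaseReal α θ p.2 δ) :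
    HasFDerivAt (fun p => ∫ u in Ioi (0 : ℝ), fourierTerm α θ k δ p u)
      (∫ u in Ioi (0 : ℝ), fourierTermDeriv α θ k δ p u) p := by
  obtain ⟨C, c, -, hc, hbound⟩ := exists_fourierBound hα hθ (δ₁ := δ) (β₁ := |p.2| + 1)
    (a₁ := |p.1| + 1) (half_pos hg)
  set s : Set (ℝ × ℝ) := {q | |q.1| < |p.1| + 1 ∧ |q.2| < |p.2| + 1
    ∧ gammaSq α θ p.2 / 2 < gammaSq α θ q.2 ∧ 0 < ntsBaseReal α θ q.2 δ} with hs
  have hsn : s ∈ 𝓝 p := by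
    have c1 : Continuous fun q : ℝ × ℝ => |q.1| := by fun_prop
    have c2 : Continuous fun q : ℝ × ℝ => |q.2| := by fun_prop
    have c3 : Continuous fun q : ℝ × ℝ => gammaSq α θ q.2 :=
      (continuous_gammaSq α θ).comp continuous_snd
    have c4 : Continuous fun q : ℝ × ℝ => ntsBaseReal α θ q.2 δ :=
      (continuous_ntsBaseReal_left α θ δ).comp continuous_snd
    refine IsOpen.mem_nhds ?_ ⟨by linarith, by linarith, half_lt_self hg, hA⟩
    exact (isOpen_lt c1 continuous_const).inter ((isOpen_lt c2 continuous_const).inter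
      ((isOpen_lt continuous_const c3).inter (isOpen_lt continuous_const c4)))
  refine hasFDerivAt_integral_of_dominated_of_fderiv_le
    (bound := fun u => (δ ^ k)⁻¹ * (C * fourierBound α c u)) hsn ?_
    (integrableOn_fourierTerm hα hθ k hδ hg hA.le)
    (aestronglyMeasurable_fourierTermDeriv k p _) ?_
    (((integrableOn_fourierBound hα hc).const_mul C).const_mul (δ ^ k)⁻¹) ?_
  · exact Eventually.of_forall fun q => (measurable_fourierTerm α θ k δ q).aestronglyMeasurable
  · filter_upwards [ae_restrict_mem measurableSet_Ioi] with u hu q hq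
    exact (norm_fourierTermDeriv_le k q u).trans (norm_fourierTerm_mul_le hδ q u
      (hbound δ q.2 q.1 u hδ le_rfl hq.2.1.le hq.2.2.1.le hq.2.2.2.le hq.1.le hu) (by positivity))
  · filter_upwards [ae_restrict_mem measurableSet_Ioi] with u hu q hq
    have hu : 0 < u := hu
    exact hasFDerivAt_fourierTerm hα.1.ne' hθ k
      (ntsBase_vline_re_pos hθ ((half_pos hg).trans hq.2.2.1) hq.2.2.2.le hu.ne')

end Differentiation

/-! ### The standard NTS laws on the real line -/

section StdNTS

variable {α θ β δ η : ℝ}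

theorem sq_mul_lt_one (hα : α ∈ Ioo (0 : ℝ) 2) (hθ : 0 < θ) (hβ : |β| < betaBound α θ) :
    β ^ 2 * ((2 - α) / (2 * θ)) < 1 := by
  have h2α : 0 < 2 - α := by linarith [hα.2]
  have h1 : β ^ 2 < 2 * θ / (2 - α) := Real.lt_sqrt (abs_nonneg β) |>.1 hβ |>.trans_eq' (sq_abs β)
  calc β ^ 2 * ((2 - α) / (2 * θ)) < 2 * θ / (2 - α) * ((2 - α) / (2 * θ)) := by gcongr
    _ = 1 := by field_simp

theorem gammaSq_pos (hα : α ∈ Ioo (0 : ℝ) 2) (hθ : 0 < θ) (hβ : |β| < betaBound α θ) :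
    0 < gammaSq α θ β := sub_pos.2 (sq_mul_lt_one hα hθ hβ)

theorem gammaCoef_sq (hα : α ∈ Ioo (0 : ℝ) 2) (hθ : 0 < θ) (hβ : |β| < betaBound α θ) :
    gammaCoef α θ β ^ 2 = gammaSq α θ β := Real.sq_sqrt (gammaSq_pos hα hθ hβ).le

theorem gammaCoef_pos (hα : α ∈ Ioo (0 : ℝ) 2) (hθ : 0 < θ) (hβ : |β| < betaBound α θ) :
    0 < gammaCoef α θ β := Real.sqrt_pos.2 (gammaSq_pos hα hθ hβ)

theorem eventually_abs_lt_betaBound (hβ : |β| < betaBound α θ) :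
    ∀ᶠ b in 𝓝 β, |b| < betaBound α θ :=
  (isOpen_lt continuous_abs continuous_const).eventually_mem hβ

theorem eventually_ntsBaseReal_pos (hA : 0 < ntsBaseReal α θ β δ) :
    ∀ᶠ b in 𝓝 β, 0 < ntsBaseReal α θ b δ :=
  (isOpen_lt continuous_const (continuous_ntsBaseReal_left α θ δ)).eventually_mem hA

theorem exists_ntsBaseReal_pos (α θ β : ℝ) : ∃ δ > 0, 0 < ntsBaseReal α θ β δ := by
  have hc : Continuous fun δ => ntsBaseReal α θ β δ := by
    unfold ntsBaseReal
    fun_prop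
  have h0 : 0 < ntsBaseReal α θ β 0 := by simp [ntsBaseReal]
  have h1 := (isOpen_lt continuous_const hc).eventually_mem h0
  obtain ⟨δ, h2, h3⟩ := ((h1.filter_mono nhdsWithin_le_nhds).and
    (self_mem_nhdsWithin (s := Ioi (0 : ℝ)))).exists
  exact ⟨δ, h3, h2⟩

/-- The abscissas of convergence form an interval, in whose interior the base is positive. -/
theorem ntsBaseReal_pos_of_lt (hθ : 0 < θ) (hg : 0 < gammaSq α θ β)
    (hA : 0 ≤ ntsBaseReal α θ β δ) {δ' : ℝ} (h0 : 0 < δ') (hlt : δ' < δ) :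
    0 < ntsBaseReal α θ β δ' := by
  have e : ntsBaseReal α θ β δ' = (δ - δ') / δ + δ' / δ * ntsBaseReal α θ β δ
      + gammaSq α θ β * (δ' * (δ - δ')) / (2 * θ) := by
    have hδ : δ ≠ 0 := (h0.trans hlt).ne'
    unfold ntsBaseReal
    field_simp
    ring
  have h1 : 0 < δ - δ' := sub_pos.2 hlt
  have h2 : 0 < δ := h0.trans hlt
  rw [e]
  positivity

theorem finiteChFOnLine_iff {m : Measure ℝ} :
    FiniteChFOnLine m δ ↔ -δ ∈ integrableExpSet id m := by
  have hn : ∀ u x : ℝ, ‖Complex.exp (Complex.I * (-u + Complex.I * δ) * x)‖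
      = ‖Real.exp (-δ * x)‖ := fun u x => by
    rw [Complex.norm_exp, Real.norm_eq_abs, Real.abs_exp]
    simp
  constructor
  · intro h
    exact ((integrable_congr' (by fun_prop) (by fun_prop)
      (Eventually.of_forall fun x => hn 0 x)).1 (h 0))
  · intro h u
    exact ((integrable_congr' (by fun_prop) (by fun_prop)
      (Eventually.of_forall fun x => hn u x)).2 h)

theorem stdNTSChF_eq (α θ β δ u : ℝ) :
    stdNTSChF (-u + Complex.I * δ) α θ β
      = complexMGF id (stdNTSLaw1 α θ β) (-vline δ u) := by
  rw [stdNTSChF, chF]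
  congr 1
  rw [vline_eq]
  linear_combination (δ : ℂ) * Complex.I_mul_I

theorem psi_eq (α θ β δ u : ℝ) :
    psi (-u + Complex.I * δ) α θ β = ntsLogDeriv α θ β (vline δ u) := by
  have hz : (-u + Complex.I * δ : ℂ) = Complex.I * vline δ u := by
    rw [vline_eq]
    linear_combination -(u : ℂ) * Complex.I_mul_I
  have hI := Complex.I_mul_I
  have e1 : (1 - Complex.I * (Complex.I * vline δ u) * β / θ
      + (1 - (β : ℂ) ^ 2 * (2 - α) / (2 * θ)) * ((Complex.I * vline δ u) ^ 2 / (2 * θ)))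
      = ntsBase α θ β (vline δ u) := by
    rw [ntsBase, gammaSq]
    push_cast
    linear_combination (-(vline δ u * β / θ) + (1 - (β : ℂ) ^ 2 * (2 - α) / (2 * θ)) *
      (vline δ u ^ 2 / (2 * θ))) * hI
  rw [psi, hz, e1, ntsLogDeriv]
  push_cast
  linear_combination (-vline δ u + ntsBase α θ β (vline δ u) ^ ((α : ℂ) / 2 - 1) *
    (vline δ u + β * ((2 - α) / (2 * θ)) * vline δ u ^ 2)) * hI

/-- If `ntsBaseReal` is nonnegative for all parameters near `β`, it is positive at `β`:
as a function of the parameter its only critical point is outside the admissible range or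
its value there is negative. -/
theorem ntsBaseReal_pos_of_eventually (hα : α ∈ Ioo (0 : ℝ) 2) (hθ : 0 < θ)
    (hβ : |β| < betaBound α θ) (hδ : 0 < δ)
    (h : ∀ᶠ b in 𝓝 β, 0 ≤ ntsBaseReal α θ b δ) : 0 < ntsBaseReal α θ β δ := by
  refine h.self_of_nhds.lt_of_ne fun h0 => ?_
  have hmin : IsLocalMin (fun b => ntsBaseReal α θ b δ) β := by
    filter_upwards [h] with b hb
    rw [← h0]
    exact hb
  have hd : HasDerivAt (fun b => ntsBaseReal α θ b δ)
      (δ * 1 / θ - -(2 * β * ((2 - α) / (2 * θ))) * (δ ^ 2 / (2 * θ))) β :=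
    ((((hasDerivAt_id' β).const_mul δ).div_const θ).const_add 1).fun_sub
      ((hasDerivAt_gammaSq α θ β).mul_const _)
  have h1 := hmin.hasDerivAt_eq_zero hd
  have hlt := sq_mul_lt_one hα hθ hβ
  have h2α : 0 < 2 - α := by linarith [hα.2]
  set v := (2 - α) / (2 * θ) with hv
  have hv0 : 0 < v := by positivity
  have hvθ : v * θ < 1 := by
    rw [hv, div_mul_eq_mul_div, div_lt_one (by positivity)]
    nlinarith [hα.1]
  have h2 : β * v * δ = -1 := by
    field_simp at h1
    nlinarith [mul_left_cancel₀ hδ.ne' (by linarith : δ * (1 + β * v * δ) = δ * 0)]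
  have h3 : 2 * θ * ntsBaseReal α θ β δ = 2 * θ + 2 * δ * β - (1 - β ^ 2 * v) * δ ^ 2 := by
    rw [ntsBaseReal, gammaSq, ← hv]
    field_simp
  rw [← h0, mul_zero] at h3
  have h4 : v * δ ^ 2 > 1 := by
    have : (β * v * δ) ^ 2 = 1 := by rw [h2]; norm_num
    have h5 : β ^ 2 * v * (v * δ ^ 2) = 1 := by linarith [this, (by ring : (β * v * δ) ^ 2 = β ^ 2 * v * (v * δ ^ 2))]
    by_contra hle
    have hle : v * δ ^ 2 ≤ 1 := not_lt.1 hle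
    nlinarith [mul_nonneg hv0.le (sq_nonneg β), mul_nonneg hv0.le (sq_nonneg δ)]
  -- multiply by `v` and use `v β δ = -1`
  have h6 : 2 * (v * θ) + 2 * (β * v * δ) - v * δ ^ 2 + (β * v * δ) ^ 2 = 0 := by
    linear_combination -v * h3
  rw [h2] at h6
  linarith

variable (h : IsTemperedStable α θ (temperedStableLaw α θ))
include h

theorem isProbabilityMeasure_stdNTSLaw1 (β : ℝ) : IsProbabilityMeasure (stdNTSLaw1 α θ β) :=
  have := h.isProbabilityMeasure
  isProbabilityMeasure_mixLaw

theorem mem_integrableExpSet_stdNTSLaw1 (hα : α ∈ Ioo (0 : ℝ) 2) (hθ : 0 < θ)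
    (hβ : |β| < betaBound α θ) : -δ ∈ integrableExpSet id (stdNTSLaw1 α θ β) ↔
      θ * (1 - ntsBaseReal α θ β δ) ∈ integrableExpSet id (temperedStableLaw α θ) := by
  have h1 := mem_integrableExpSet_mixLaw (b := β) (τ := gammaCoef α θ β) (r := -δ)
    (h.ae_pos.mono fun _ => le_of_lt)
  have e : -δ * β + (-δ) ^ 2 * gammaCoef α θ β ^ 2 / 2 = θ * (1 - ntsBaseReal α θ β δ) := by
    rw [gammaCoef_sq hα hθ hβ, ntsBaseReal]
    field_simp
    ring
  rwa [e] at h1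

theorem mem_integrableExpSet_of_ntsBaseReal_pos (hα : α ∈ Ioo (0 : ℝ) 2) (hθ : 0 < θ)
    (hβ : |β| < betaBound α θ) (hA : 0 < ntsBaseReal α θ β δ) :
    -δ ∈ integrableExpSet id (stdNTSLaw1 α θ β) := by
  rw [mem_integrableExpSet_stdNTSLaw1 h hα hθ hβ]
  refine h.Iio_subset hα hθ ?_
  rw [mem_Iio]
  nlinarith

theorem ntsBaseReal_nonneg (hα : α ∈ Ioo (0 : ℝ) 2) (hθ : 0 < θ)
    (hβ : |β| < betaBound α θ) (hm : -δ ∈ integrableExpSet id (stdNTSLaw1 α θ β)) :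
    0 ≤ ntsBaseReal α θ β δ := by
  rw [mem_integrableExpSet_stdNTSLaw1 h hα hθ hβ] at hm
  have := h.integrableExpSet_subset hα hθ hm
  rw [mem_Iic] at this
  nlinarith

theorem complexMGF_stdNTSLaw1 (hα : α ∈ Ioo (0 : ℝ) 2) (hθ : 0 < θ)
    (hβ : |β| < betaBound α θ) (hm : -δ ∈ integrableExpSet id (stdNTSLaw1 α θ β)) {u : ℝ}
    (hre : 0 < (ntsBase α θ β (vline δ u)).re) :
    complexMGF id (stdNTSLaw1 α θ β) (-vline δ u) = ntsMGF α θ β (vline δ u) := by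
  have := h.isProbabilityMeasure
  have hθ' : (θ : ℂ) ≠ 0 := by exact_mod_cast hθ.ne'
  have h1 := complexMGF_mixLaw (b := β) (τ := gammaCoef α θ β)
    (h.ae_pos.mono fun _ => le_of_lt) (z := -vline δ u) hm
  have hg : ((gammaCoef α θ β : ℝ) : ℂ) ^ 2 = gammaSq α θ β := by
    rw [← Complex.ofReal_pow, gammaCoef_sq hα hθ hβ]
  have e : -vline δ u * β + (-vline δ u) ^ 2 * (gammaCoef α θ β : ℂ) ^ 2 / 2
      = θ * (1 - ntsBase α θ β (vline δ u)) := by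
    rw [hg, ntsBase]
    field_simp
    ring
  have hlt : ((θ : ℂ) * (1 - ntsBase α θ β (vline δ u))).re < θ := by
    rw [Complex.re_ofReal_mul, Complex.sub_re, Complex.one_re]
    nlinarith
  have e2 : 1 - (θ : ℂ) * (1 - ntsBase α θ β (vline δ u)) / θ = ntsBase α θ β (vline δ u) := by
    field_simp
    ring
  rw [e, h.complexMGF_eq hα hθ hlt, tsMGF, e2, ← Complex.exp_add] at h1
  refine h1.trans ?_
  rw [ntsMGF]
  congr 1
  ring

theorem integral_max_sub_stdNTSLaw1 (hα : α ∈ Ioo (0 : ℝ) 2) (hθ : 0 < θ) (hδ : 0 < δ)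
    (hβ : |β| < betaBound α θ) (hA : 0 < ntsBaseReal α θ β δ) (a : ℝ) :
    ∫ x, max (a - x) 0 ∂stdNTSLaw1 α θ β
      = 1 / Real.pi * (∫ u in Ioi (0 : ℝ), fourierTerm α θ 2 δ (a, β) u).re := by
  have := isProbabilityMeasure_stdNTSLaw1 h β
  have hm := mem_integrableExpSet_of_ntsBaseReal_pos h hα hθ hβ hA
  rw [integral_max_sub hδ hm]
  congr 2
  refine setIntegral_congr_fun measurableSet_Ioi fun u hu => ?_
  have hu : 0 < u := hu
  simp only [fourierTerm]
  rw [complexMGF_stdNTSLaw1 h hα hθ hβ hm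
    (ntsBase_vline_re_pos hθ (gammaSq_pos hα hθ hβ) hA.le hu.ne')]

theorem integrable_id_stdNTSLaw1 (hα : α ∈ Ioo (0 : ℝ) 2) (hθ : 0 < θ) (β : ℝ) :
    Integrable id (stdNTSLaw1 α θ β) := h.integrable_mixLaw hα hθ

theorem cdf_stdNTSLaw1 (hα : α ∈ Ioo (0 : ℝ) 2) (hθ : 0 < θ) (hδ : 0 < δ)
    (hβ : |β| < betaBound α θ) (hA : 0 < ntsBaseReal α θ β δ) (a : ℝ) :
    cdf (stdNTSLaw1 α θ β) a
      = 1 / Real.pi * (∫ u in Ioi (0 : ℝ), fourierTerm α θ 1 δ (a, β) u).re := by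
  have := isProbabilityMeasure_stdNTSLaw1 h β
  have hg := gammaSq_pos hα hθ hβ
  have h1 := hasFDerivAt_integral_fourierTerm hα hθ 2 hδ (p := (a, β)) hg hA
  have hline : HasDerivAt (fun a : ℝ => (a, β)) ((1 : ℝ), (0 : ℝ)) a :=
    (hasDerivAt_id a).prodMk (hasDerivAt_const a β)
  have h2 := HasFDerivAt.comp_hasDerivAt (f := fun a : ℝ => (a, β)) a h1 hline
  rw [ContinuousLinearMap.integral_apply
    (integrableOn_fourierTermDeriv hα hθ 2 hδ (p := (a, β)) hg hA.le)] at h2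
  have h3 := (Complex.reCLM.hasFDerivAt.comp_hasDerivAt a h2).const_mul (1 / Real.pi)
  have h4 : (fun a => ∫ x, max (a - x) 0 ∂stdNTSLaw1 α θ β)
      = fun a => 1 / Real.pi * (∫ u in Ioi (0 : ℝ), fourierTerm α θ 2 δ (a, β) u).re :=
    funext fun a => integral_max_sub_stdNTSLaw1 h hα hθ hδ hβ hA a
  have h5 := hasDerivAt_integral_max_sub_eq_cdf (integrable_id_stdNTSLaw1 h hα hθ β)
    (h4 ▸ h3)
  rw [← h5, Complex.reCLM_apply]
  congr 2
  refine setIntegral_congr_fun measurableSet_Ioi fun u _ => ?_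
  simp only [fourierTermDeriv_apply, fourierTerm]
  have hs := vline_ne_zero (u := u) hδ
  field_simp
  push_cast
  ring

/-- The distribution functions of the standard NTS laws are jointly differentiable in the
argument and the parameter, with positive density. -/
theorem exists_hasFDerivAt_cdf (hα : α ∈ Ioo (0 : ℝ) 2) (hθ : 0 < θ)
    (hβ : |β| < betaBound α θ) (a : ℝ) : ∃ L : ℝ × ℝ →L[ℝ] ℝ, 0 < L (1, 0) ∧
      HasFDerivAt (fun p : ℝ × ℝ => cdf (stdNTSLaw1 α θ p.2) p.1) L (a, β) := by
  have := isProbabilityMeasure_stdNTSLaw1 h β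
  have := h.isProbabilityMeasure
  obtain ⟨δ, hδ, hA⟩ := exists_ntsBaseReal_pos α θ β
  have h1 := hasFDerivAt_integral_fourierTerm hα hθ 1 hδ (p := (a, β)) (gammaSq_pos hα hθ hβ) hA
  have h2 := (Complex.reCLM.hasFDerivAt.comp (a, β) h1).const_mul (1 / Real.pi)
  have heq : (fun p : ℝ × ℝ => cdf (stdNTSLaw1 α θ p.2) p.1) =ᶠ[𝓝 (a, β)] fun p =>
      1 / Real.pi * (Complex.reCLM ∘ fun p => ∫ u in Ioi (0 : ℝ), fourierTerm α θ 1 δ p u) p := by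
    have hev := (eventually_abs_lt_betaBound hβ).and (eventually_ntsBaseReal_pos hA)
    filter_upwards [(continuous_snd.tendsto (a, β)).eventually hev] with p hp
    exact cdf_stdNTSLaw1 h hα hθ hδ hp.1 hp.2 p.1
  have h3 := h2.congr_of_eventuallyEq heq
  refine ⟨_, ?_, h3⟩
  set L := (1 / Real.pi) • Complex.reCLM.comp
    (∫ u in Ioi (0 : ℝ), fourierTermDeriv α θ 1 δ (a, β) u)
  have hline : HasDerivAt (fun a : ℝ => (a, β)) ((1 : ℝ), (0 : ℝ)) a :=
    (hasDerivAt_id a).prodMk (hasDerivAt_const a β)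
  have h4 : HasDerivAt (fun a => cdf (stdNTSLaw1 α θ β) a) (L (1, 0)) a :=
    HasFDerivAt.comp_hasDerivAt (f := fun a : ℝ => (a, β)) a h3 hline
  obtain ⟨c, hc, hle⟩ := exists_mul_le_mixLaw_Ioc (b := β) h.ae_pos
    (gammaCoef_pos hα hθ hβ) a
  refine hc.trans_le ?_
  have hs := (hasDerivAt_iff_tendsto_slope_zero.1 h4).mono_left
    (nhdsWithin_mono 0 (t := {0}ᶜ) (s := Ioi 0) fun x hx => ne_of_gt hx)
  refine ge_of_tendsto hs ?_
  filter_upwards [self_mem_nhdsWithin, Ioo_mem_nhdsGT (zero_lt_one (α := ℝ))] with t ht ht1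
  have ht : 0 < t := ht
  have hIoc : cdf (stdNTSLaw1 α θ β) (a + t) - cdf (stdNTSLaw1 α θ β) a
      = (stdNTSLaw1 α θ β).real (Ioc a (a + t)) := by
    rw [cdf_eq_real, cdf_eq_real, ← measureReal_sdiff (Iic_subset_Iic.2 (by linarith))
      measurableSet_Iic, Iic_sdiff_Iic]
  rw [smul_eq_mul, hIoc, le_inv_mul_iff₀ ht, mul_comm]
  exact hle t ⟨ht.le, ht1.2.le⟩

theorem differentiableAt_stdNTSQuantile (hα : α ∈ Ioo (0 : ℝ) 2) (hθ : 0 < θ)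
    (hη : η ∈ Ioo (0 : ℝ) 1) (hβ : |β| < betaBound α θ) :
    DifferentiableAt ℝ (fun b => stdNTSQuantile η α θ b) β := by
  obtain ⟨L, hL, hF⟩ := exists_hasFDerivAt_cdf h hα hθ hβ (quantile (stdNTSLaw1 α θ β) η)
  have hc : ContinuousAt (cdf (stdNTSLaw1 α θ β)) (quantile (stdNTSLaw1 α θ β) η) :=
    ContinuousAt.comp (f := fun a : ℝ => (a, β)) hF.continuousAt (by fun_prop)
  exact (hasDerivAt_quantile hη rfl rfl hL hF (cdf_quantile hη hc)).differentiableAt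

theorem hasDerivAt_stdNTSCVaR_of_pos (hα : α ∈ Ioo (0 : ℝ) 2) (hθ : 0 < θ)
    (hη : η ∈ Ioo (0 : ℝ) 1) (hδ : 0 < δ) (hβ : |β| < betaBound α θ)
    (hA : 0 < ntsBaseReal α θ β δ) {q' : ℝ}
    (hq : HasDerivAt (fun b => stdNTSQuantile η α θ b) q' β) :
    HasDerivAt (fun b => stdNTSCVaR η α θ b) (-q' + 1 / η * (1 / Real.pi *
      (∫ u in Ioi (0 : ℝ), fourierTermDeriv α θ 2 δ (stdNTSQuantile η α θ β, β) u (q', 1)).re))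
      β := by
  have hg := gammaSq_pos hα hθ hβ
  have h1 := hasFDerivAt_integral_fourierTerm hα hθ 2 hδ
    (p := (stdNTSQuantile η α θ β, β)) hg hA
  have hline : HasDerivAt (fun b : ℝ => (stdNTSQuantile η α θ b, b)) (q', (1 : ℝ)) β :=
    hq.prodMk (hasDerivAt_id β)
  have h2 := HasFDerivAt.comp_hasDerivAt (f := fun b : ℝ => (stdNTSQuantile η α θ b, b)) β h1 hline
  rw [ContinuousLinearMap.integral_apply
    (integrableOn_fourierTermDeriv hα hθ 2 hδ (p := (stdNTSQuantile η α θ β, β)) hg hA.le)] at h2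
  have h3 := hq.fun_neg.fun_add (((Complex.reCLM.hasFDerivAt.comp_hasDerivAt β h2).const_mul
    (1 / Real.pi)).const_mul (1 / η))
  refine h3.congr_of_eventuallyEq ?_
  filter_upwards [eventually_abs_lt_betaBound hβ, eventually_ntsBaseReal_pos hA] with b hb hAb
  have := isProbabilityMeasure_stdNTSLaw1 h b
  rw [stdNTSCVaR, CVaR_eq (integrable_id_stdNTSLaw1 h hα hθ b) hη,
    integral_max_sub_stdNTSLaw1 h hα hθ hδ hb hAb]
  rfl

omit h in
theorem continuousAt_fourierTermDeriv_apply (hδ : 0 < δ) (k : ℕ) {p : ℝ × ℝ} (v : ℝ × ℝ) {u : ℝ}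
    (hre : 0 < (ntsBase α θ p.2 (vline δ u)).re) :
    ContinuousAt (fun δ => fourierTermDeriv α θ k δ p u v) δ := by
  have hv : Continuous fun δ : ℝ => vline δ u := by
    simp only [vline_eq]
    fun_prop
  have hb : ContinuousAt (fun δ : ℝ => ntsBase α θ p.2 (vline δ u)) δ := by
    unfold ntsBase
    exact Continuous.continuousAt (by fun_prop)
  have hp : ∀ r : ℂ, ContinuousAt (fun δ : ℝ => ntsBase α θ p.2 (vline δ u) ^ r) δ := fun r =>
    hb.cpow continuousAt_const (Or.inl hre)
  have h1 := hp ((α / 2 : ℝ) : ℂ)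
  have h2 := hp ((α / 2 - 1 : ℝ) : ℂ)
  have h3 := hv.continuousAt (x := δ)
  simp only [fourierTermDeriv_apply, fourierTerm, ntsMGF, ntsLogDeriv]
  refine ContinuousAt.mul (ContinuousAt.div ?_ (h3.pow k) (pow_ne_zero k (vline_ne_zero hδ))) ?_
  · fun_prop
  · fun_prop

omit h in
/-- The Fourier integrals depend left-continuously on the abscissa `δ`, up to the boundary of
the region of convergence. -/
theorem tendsto_integral_fourierTermDeriv (hα : α ∈ Ioo (0 : ℝ) 2) (hθ : 0 < θ) (k : ℕ)
    (hδ : 0 < δ) {p : ℝ × ℝ} (v : ℝ × ℝ) (hg : 0 < gammaSq α θ p.2)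
    (hA : 0 ≤ ntsBaseReal α θ p.2 δ) :
    Tendsto (fun δ => ∫ u in Ioi (0 : ℝ), fourierTermDeriv α θ k δ p u v) (𝓝[<] δ)
      (𝓝 (∫ u in Ioi (0 : ℝ), fourierTermDeriv α θ k δ p u v)) := by
  obtain ⟨C, c, hC, hc, hbound⟩ :=
    exists_fourierBound hα hθ (δ₁ := δ) (β₁ := |p.2|) (a₁ := |p.1|) hg
  refine tendsto_integral_filter_of_dominated_convergence
    (fun u => ((δ / 2) ^ k)⁻¹ * (C * fourierBound α c u) * ‖v‖) ?_ ?_ ?_ ?_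
  · exact Eventually.of_forall fun δ =>
      (aestronglyMeasurable_fourierTermDeriv k p _).apply_continuousLinearMap v
  · filter_upwards [Ioo_mem_nhdsLT (half_lt_self hδ)] with δ' hδ'
    have hδ0 : 0 < δ' := (half_pos hδ).trans hδ'.1
    filter_upwards [ae_restrict_mem measurableSet_Ioi] with u hu
    refine (ContinuousLinearMap.le_opNorm _ _).trans
      (mul_le_mul_of_nonneg_right ?_ (norm_nonneg v))
    have h1 := hbound δ' p.2 p.1 u hδ0 hδ'.2.le le_rfl le_rfl
      (ntsBaseReal_pos_of_lt hθ hg hA hδ0 hδ'.2).le le_rfl hu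
    refine ((norm_fourierTermDeriv_le k p u).trans
      (norm_fourierTerm_mul_le hδ0 p u h1 (by positivity))).trans ?_
    refine mul_le_mul_of_nonneg_right ?_ (le_trans (by positivity) h1)
    exact inv_anti₀ (by positivity) (pow_le_pow_left₀ (half_pos hδ).le hδ'.1.le k)
  · exact (((integrableOn_fourierBound hα hc).const_mul C).const_mul _).mul_const _
  · filter_upwards [ae_restrict_mem measurableSet_Ioi] with u hu
    have hu : 0 < u := hu
    exact (continuousAt_fourierTermDeriv_apply hδ k v
      (ntsBase_vline_re_pos hθ hg hA hu.ne')).tendsto.mono_left nhdsWithin_le_nhds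

theorem hasDerivAt_stdNTSCVaR (hα : α ∈ Ioo (0 : ℝ) 2) (hθ : 0 < θ)
    (hη : η ∈ Ioo (0 : ℝ) 1) (hδ : 0 < δ) (hβ : |β| < betaBound α θ)
    (hA : 0 ≤ ntsBaseReal α θ β δ) {q' : ℝ}
    (hq : HasDerivAt (fun b => stdNTSQuantile η α θ b) q' β) :
    HasDerivAt (fun b => stdNTSCVaR η α θ b) (-q' + 1 / η * (1 / Real.pi *
      (∫ u in Ioi (0 : ℝ), fourierTermDeriv α θ 2 δ (stdNTSQuantile η α θ β, β) u (q', 1)).re))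
      β := by
  have hg := gammaSq_pos hα hθ hβ
  obtain ⟨δ₀, hδ₀, hA₀⟩ := exists_ntsBaseReal_pos α θ β
  refine (hasDerivAt_stdNTSCVaR_of_pos h hα hθ hη hδ₀ hβ hA₀ hq).congr_deriv ?_
  -- the formula is constant in `δ` on the open interval of convergence
  have hlim := tendsto_integral_fourierTermDeriv hα hθ 2 hδ
    (p := (stdNTSQuantile η α θ β, β)) (q', 1) hg hA
  have hlim2 := (((Complex.continuous_re.tendsto _).comp hlim).const_mul (1 / Real.pi)).const_mul
    (1 / η) |>.const_add (-q')
  refine tendsto_nhds_unique (tendsto_const_nhds.congr' ?_) hlim2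
  filter_upwards [Ioo_mem_nhdsLT hδ] with δ' hδ'
  exact (hasDerivAt_stdNTSCVaR_of_pos h hα hθ hη hδ₀ hβ hA₀ hq).unique
    (hasDerivAt_stdNTSCVaR_of_pos h hα hθ hη hδ'.1 hβ
      (ntsBaseReal_pos_of_lt hθ hg hA hδ'.1 hδ'.2) hq)

theorem cvarIntegrand_eq (hα : α ∈ Ioo (0 : ℝ) 2) (hθ : 0 < θ) (hδ : 0 < δ)
    (hβ : |β| < betaBound α θ) (hm : -δ ∈ integrableExpSet id (stdNTSLaw1 α θ β)) {u : ℝ}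
    (hu : 0 < u) : cvarIntegrand η α θ β δ u
      = -fourierTermDeriv α θ 2 δ (stdNTSQuantile η α θ β, β) u
        (deriv (fun b => stdNTSQuantile η α θ b) β, 1) := by
  have hre := ntsBase_vline_re_pos hθ (gammaSq_pos hα hθ hβ)
    (ntsBaseReal_nonneg h hα hθ hβ hm) hu.ne'
  have e1 : (Complex.I * u + δ : ℂ) = vline δ u := by
    rw [vline_eq]
    ring
  have e2 : (δ + Complex.I * u : ℂ) = vline δ u := by
    rw [vline_eq]
    ring
  have e3 : (-u + Complex.I * δ : ℂ) ^ 2 = -vline δ u ^ 2 := by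
    rw [vline_eq]
    linear_combination ((δ : ℂ) ^ 2 + u ^ 2) * Complex.I_sq
  rw [cvarIntegrand, stdNTSChF_eq, psi_eq, complexMGF_stdNTSLaw1 h hα hθ hβ hm hre, e1, e2, e3,
    fourierTermDeriv_apply, fourierTerm]
  have hs := vline_ne_zero (u := u) hδ
  push_cast
  field_simp

theorem hasDerivAt_stdNTSChF (hα : α ∈ Ioo (0 : ℝ) 2) (hθ : 0 < θ) (hδ : 0 < δ)
    (hβ : |β| < betaBound α θ)
    (hfin : ∀ᶠ b in 𝓝 β, FiniteChFOnLine (stdNTSLaw1 α θ b) δ) (u : ℝ) :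
    HasDerivAt (fun b => stdNTSChF (-u + Complex.I * δ) α θ b)
      (stdNTSChF (-u + Complex.I * δ) α θ β * psi (-u + Complex.I * δ) α θ β) β := by
  have hA : 0 < ntsBaseReal α θ β δ := by
    refine ntsBaseReal_pos_of_eventually hα hθ hβ hδ ?_
    filter_upwards [hfin, eventually_abs_lt_betaBound hβ] with b hb hb'
    exact ntsBaseReal_nonneg h hα hθ hb' (finiteChFOnLine_iff.1 hb)
  have hre : ∀ b, |b| < betaBound α θ → 0 < ntsBaseReal α θ b δ →
      0 < (ntsBase α θ b (vline δ u)).re := fun b hb hAb => by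
    have := gammaSq_pos hα hθ hb
    rw [ntsBase_vline_re]
    positivity
  have heq : ∀ b, |b| < betaBound α θ → 0 < ntsBaseReal α θ b δ →
      stdNTSChF (-u + Complex.I * δ) α θ b = ntsMGF α θ b (vline δ u) := fun b hb hAb => by
    rw [stdNTSChF_eq, complexMGF_stdNTSLaw1 h hα hθ hb
      (mem_integrableExpSet_of_ntsBaseReal_pos h hα hθ hb hAb) (hre b hb hAb)]
  rw [psi_eq, heq β hβ hA]
  refine (hasDerivAt_ntsMGF hα.1.ne' hθ (hre β hβ hA)).congr_of_eventuallyEq ?_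
  filter_upwards [eventually_abs_lt_betaBound hβ, eventually_ntsBaseReal_pos hA] with b hb hAb
  exact heq b hb hAb

end StdNTS

/-! ### Portfolios -/

section PortfolioLaw

/-- A linear functional of a centered Gaussian vector is a multiple of a standard normal
variable. -/
theorem exists_map_sum_multivariateGaussian {N : ℕ} (C : Matrix (Fin N) (Fin N) ℝ)
    (a : Fin N → ℝ) : ∃ τ : ℝ, 0 ≤ τ ∧
      (multivariateGaussian 0 C).map (fun x => ∑ k, a k * x k)
        = (gaussianReal 0 1).map (fun y => τ * y) := by
  set ℓ : EuclideanSpace ℝ (Fin N) →L[ℝ] ℝ := ∑ k, a k • EuclideanSpace.proj k with hℓ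
  have hfun : (fun x : EuclideanSpace ℝ (Fin N) => ∑ k, a k * x k) = ℓ := by
    ext x
    simp [hℓ]
  refine ⟨√(Var[ℓ; multivariateGaussian 0 C]), Real.sqrt_nonneg _, ?_⟩
  rw [hfun, IsGaussian.map_eq_gaussianReal, gaussianReal_map_const_mul,
    ContinuousLinearMap.integral_comp_id_comm IsGaussian.integrable_id,
    integral_id_multivariateGaussian, map_zero, mul_zero]
  congr 1
  ext
  simp [Real.sq_sqrt (variance_nonneg _ _), variance_nonneg]

theorem map_const_mul_mixLaw (m : Measure ℝ) (b τ c : ℝ) :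
    (mixLaw m b τ).map (fun x => c * x) = mixLaw m (c * b) (c * τ) := by
  rw [mixLaw, Measure.map_map (by fun_prop) (by fun_prop), mixLaw]
  congr 1
  ext p
  simp only [Function.comp_apply]
  ring

variable {Ω : Type*} [MeasurableSpace Ω] {P : Measure Ω}
  {N : ℕ} {α θ η : ℝ} {β μ σ : Fin N → ℝ} {C : Matrix (Fin N) (Fin N) ℝ} {X : Ω → Fin N → ℝ}
  {R : Fin N → Ω → ℝ}

theorem aemeasurable_portfolioReturn (hX : HasLaw X (stdNTSLaw α θ β C) P)
    (hR : ∀ n ω, R n ω = μ n + σ n * X ω n) (v : Fin N → ℝ) :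
    AEMeasurable (portfolioReturn R v) P := by
  have hg : Measurable fun x : Fin N → ℝ => ∑ k, v k * (μ k + σ k * x k) := by fun_prop
  have : portfolioReturn R v = (fun x : Fin N → ℝ => ∑ k, v k * (μ k + σ k * x k)) ∘ X := by
    ext ω
    simp [portfolioReturn, hR]
  rw [this]
  exact hg.comp_aemeasurable hX.aemeasurable

variable [IsProbabilityMeasure P]

/-- A random vector with law `stdNTSLaw` can only exist if the subordinator exists. -/
theorem isTemperedStable_of_hasLaw (hX : HasLaw X (stdNTSLaw α θ β C) P) :
    IsTemperedStable α θ (temperedStableLaw α θ) := by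
  by_cases hex : ∃ m, IsTemperedStable α θ m
  · rw [temperedStableLaw, dif_pos hex]
    exact hex.choose_spec
  · have h0 : stdNTSLaw α θ β C = 0 := by
      rw [stdNTSLaw, temperedStableLaw, dif_neg hex, Measure.zero_prod, Measure.map_zero]
    have := Measure.isProbabilityMeasure_map hX.aemeasurable (μ := P)
    rw [hX.map_eq, h0] at this
    exact absurd rfl (IsProbabilityMeasure.ne_zero (0 : Measure (Fin N → ℝ)))

theorem exists_map_portfolioReturn (hX : HasLaw X (stdNTSLaw α θ β C) P)
    (hR : ∀ n ω, R n ω = μ n + σ n * X ω n) (v : Fin N → ℝ) :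
    ∃ τ : ℝ, 0 ≤ τ ∧ P.map (portfolioReturn R v)
      = (mixLaw (temperedStableLaw α θ) (∑ k, v k * σ k * β k) τ).map
        (fun x => ∑ k, v k * μ k + x) := by
  have := (isTemperedStable_of_hasLaw hX).isProbabilityMeasure
  obtain ⟨τ, hτ, hmap⟩ := exists_map_sum_multivariateGaussian C
    (fun k => v k * σ k * gammaCoef α θ (β k))
  refine ⟨τ, hτ, ?_⟩
  set m := temperedStableLaw α θ
  set b := ∑ k, v k * σ k * β k with hb
  set c := ∑ k, v k * μ k with hc
  set G : ℝ × ℝ → ℝ := fun p => c + (b * (p.1 - 1) + p.2 * √p.1) with hG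
  have hGm : Measurable G := by
    rw [hG]
    fun_prop
  have hgm : Measurable fun x : Fin N → ℝ => ∑ k, v k * (μ k + σ k * x k) := by fun_prop
  have hlm : Measurable fun x : EuclideanSpace ℝ (Fin N) =>
      ∑ k, v k * σ k * gammaCoef α θ (β k) * x k := by fun_prop
  have hfm : Measurable fun (p : ℝ × EuclideanSpace ℝ (Fin N)) (n : Fin N) =>
      β n * (p.1 - 1) + gammaCoef α θ (β n) * p.2 n * √p.1 := by fun_prop
  have h1 : P.map (portfolioReturn R v)
      = (m.prod ((multivariateGaussian 0 C).map fun x =>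
        ∑ k, v k * σ k * gammaCoef α θ (β k) * x k)).map G := by
    have e : portfolioReturn R v = (fun x : Fin N → ℝ => ∑ k, v k * (μ k + σ k * x k)) ∘ X := by
      ext ω
      simp [portfolioReturn, hR]
    rw [e, ← AEMeasurable.map_map_of_aemeasurable hgm.aemeasurable hX.aemeasurable, hX.map_eq,
      stdNTSLaw, Measure.map_map hgm hfm]
    conv_rhs => rw [← Measure.map_id (μ := m)]
    rw [Measure.map_prod_map _ _ measurable_id hlm,
      Measure.map_map hGm (measurable_id.prodMap hlm)]
    congr 1
    ext p
    simp only [Function.comp_apply, Prod.map, id, hG, hc, hb, Finset.sum_mul,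
      ← Finset.sum_add_distrib]
    refine Finset.sum_congr rfl fun k _ => ?_
    ring
  have h2 : (mixLaw m b τ).map (fun x => c + x)
      = (m.prod ((gaussianReal 0 1).map fun y => τ * y)).map G := by
    conv_rhs => rw [← Measure.map_id (μ := m)]
    rw [Measure.map_prod_map _ _ measurable_id (by fun_prop),
      Measure.map_map hGm (measurable_id.prodMap (by fun_prop)), mixLaw,
      Measure.map_map (by fun_prop) (by fun_prop)]
    rfl
  rw [h1, hmap, h2]

theorem memLp_portfolioReturn (hα : α ∈ Ioo (0 : ℝ) 2) (hθ : 0 < θ)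
    (hX : HasLaw X (stdNTSLaw α θ β C) P)
    (hR : ∀ n ω, R n ω = μ n + σ n * X ω n) (v : Fin N → ℝ) :
    MemLp (portfolioReturn R v) 2 P := by
  have h := isTemperedStable_of_hasLaw hX
  have := h.isProbabilityMeasure
  obtain ⟨τ, -, hmap⟩ := exists_map_portfolioReturn hX hR v
  have hlin : Measurable fun x : ℝ => ∑ k, v k * μ k + x := by fun_prop
  have h1 : MemLp id 2 (P.map (portfolioReturn R v)) := by
    have h0 : MemLp id 2 (mixLaw (temperedStableLaw α θ) (∑ k, v k * σ k * β k) τ) :=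
      h.memLp_mixLaw hα hθ
    have h2 := (memLp_const (∑ k, v k * μ k)).add h0
    rw [hmap]
    exact (memLp_map_measure_iff aestronglyMeasurable_id hlin.aemeasurable).2 h2
  exact (memLp_map_measure_iff aestronglyMeasurable_id
    (aemeasurable_portfolioReturn hX hR v)).1 h1

theorem integrable_map_portfolioReturn (hα : α ∈ Ioo (0 : ℝ) 2) (hθ : 0 < θ)
    (hX : HasLaw X (stdNTSLaw α θ β C) P)
    (hR : ∀ n ω, R n ω = μ n + σ n * X ω n) (v : Fin N → ℝ) :
    Integrable id (P.map (portfolioReturn R v)) :=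
  (integrable_map_measure aestronglyMeasurable_id (aemeasurable_portfolioReturn hX hR v)).2
    ((memLp_portfolioReturn hα hθ hX hR v).integrable one_le_two)

/-- The quadratic form of the covariance matrix is the variance of the portfolio return. -/
theorem sum_cov_eq_variance (hα : α ∈ Ioo (0 : ℝ) 2) (hθ : 0 < θ)
    (hX : HasLaw X (stdNTSLaw α θ β C) P)
    (hR : ∀ n ω, R n ω = μ n + σ n * X ω n) (v : Fin N → ℝ) :
    ∑ k, ∑ l, v k * v l * cov[R k, R l; P] = Var[portfolioReturn R v; P] := by
  have hmem : ∀ k, MemLp (fun ω => v k * R k ω) 2 P := fun k => by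
    have := memLp_portfolioReturn hα hθ hX hR (Pi.single k 1)
    have e : portfolioReturn R (Pi.single k 1) = R k := by
      ext ω
      simp [portfolioReturn, Pi.single_apply]
    rw [e] at this
    exact this.const_mul _
  have := variance_fun_sum' (s := Finset.univ) (fun k _ => hmem k)
  refine Eq.trans ?_ this.symm
  refine Finset.sum_congr rfl fun k _ => Finset.sum_congr rfl fun l _ => ?_
  rw [covariance_const_mul_left, covariance_const_mul_right]
  ring

/-- A portfolio return of nonzero variance is an affine image of a standard NTS variable with
parameter `betaBar`. -/
theorem map_portfolioReturn (hα : α ∈ Ioo (0 : ℝ) 2) (hθ : 0 < θ)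
    (hX : HasLaw X (stdNTSLaw α θ β C) P)
    (hR : ∀ n ω, R n ω = μ n + σ n * X ω n) {v : Fin N → ℝ} (hv : 0 < sigmaBar P R v) :
    P.map (portfolioReturn R v) = (stdNTSLaw1 α θ (betaBar P R σ β v)).map
      (fun x => ∑ k, v k * μ k + sigmaBar P R v * x) := by
  have h := isTemperedStable_of_hasLaw hX
  have := h.isProbabilityMeasure
  obtain ⟨τ, hτ, hmap⟩ := exists_map_portfolioReturn hX hR v
  set b := ∑ k, v k * σ k * β k with hb
  set s := sigmaBar P R v with hs
  have hlin : Measurable fun x : ℝ => ∑ k, v k * μ k + x := by fun_prop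
  have hvar : Var[portfolioReturn R v; P] = b ^ 2 * ((2 - α) / (2 * θ)) + τ ^ 2 := by
    rw [← h.variance_mixLaw hα hθ, ← variance_id_map (aemeasurable_portfolioReturn hX hR v), hmap,
      variance_id_map hlin.aemeasurable]
    exact variance_const_add aestronglyMeasurable_id _
  have hs2 : s ^ 2 = b ^ 2 * ((2 - α) / (2 * θ)) + τ ^ 2 := by
    rw [hs, sigmaBar, sum_cov_eq_variance hα hθ hX hR, Real.sq_sqrt (variance_nonneg _ _), hvar]
  have hbeta : betaBar P R σ β v = b / s := rfl
  have hτs : τ = s * gammaCoef α θ (b / s) := by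
    have h1 : 1 - (b / s) ^ 2 * ((2 - α) / (2 * θ)) = (τ / s) ^ 2 := by
      rw [div_pow, div_pow, eq_div_iff (by positivity)]
      field_simp
      field_simp at hs2
      linarith
    rw [gammaCoef, h1, Real.sqrt_sq (by positivity)]
    field_simp
  have hcomp : (fun x => ∑ k, v k * μ k + s * x)
      = (fun x => ∑ k, v k * μ k + x) ∘ fun x => s * x := rfl
  rw [hcomp, ← Measure.map_map hlin (by fun_prop), hbeta]
  change _ = Measure.map _ (Measure.map _ (mixLaw _ _ _))
  rw [map_const_mul_mixLaw, ← hτs, mul_div_cancel₀ _ hv.ne', hmap]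

theorem VaR_portfolioReturn (hα : α ∈ Ioo (0 : ℝ) 2) (hθ : 0 < θ) (hη : η ∈ Ioo (0 : ℝ) 1)
    (hX : HasLaw X (stdNTSLaw α θ β C) P)
    (hR : ∀ n ω, R n ω = μ n + σ n * X ω n) {v : Fin N → ℝ} (hv : 0 < sigmaBar P R v) :
    VaR (P.map (portfolioReturn R v)) η = -∑ k, v k * μ k
      - sigmaBar P R v * stdNTSQuantile η α θ (betaBar P R σ β v) := by
  have := isProbabilityMeasure_stdNTSLaw1 (isTemperedStable_of_hasLaw hX) (betaBar P R σ β v)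
  rw [map_portfolioReturn hα hθ hX hR hv, VaR, quantile_map_affine hv hη, stdNTSQuantile]
  ring

theorem CVaR_portfolioReturn (hα : α ∈ Ioo (0 : ℝ) 2) (hθ : 0 < θ) (hη : η ∈ Ioo (0 : ℝ) 1)
    (hX : HasLaw X (stdNTSLaw α θ β C) P)
    (hR : ∀ n ω, R n ω = μ n + σ n * X ω n) {v : Fin N → ℝ} (hv : 0 < sigmaBar P R v) :
    CVaR (P.map (portfolioReturn R v)) η = -∑ k, v k * μ k
      + sigmaBar P R v * stdNTSCVaR η α θ (betaBar P R σ β v) := by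
  have h := isTemperedStable_of_hasLaw hX
  have := isProbabilityMeasure_stdNTSLaw1 h (betaBar P R σ β v)
  rw [map_portfolioReturn hα hθ hX hR hv,
    CVaR_map_affine (integrable_id_stdNTSLaw1 h hα hθ _) hv hη, stdNTSCVaR]

end PortfolioLaw

section PortfolioDeriv

variable {Ω : Type*} [MeasurableSpace Ω] {P : Measure Ω} {N : ℕ} {R : Fin N → Ω → ℝ}
  {w : Fin N → ℝ}

theorem hasDerivAt_update_apply (w : Fin N → ℝ) (n k : Fin N) (t : ℝ) :
    HasDerivAt (fun t => Function.update w n t k) (Pi.single (M := fun _ => ℝ) n 1 k) t :=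
  hasDerivAt_pi.1 (hasDerivAt_update w n t) k

theorem hasDerivAt_sum_update_mul (w c : Fin N → ℝ) (n : Fin N) (t : ℝ) :
    HasDerivAt (fun t => ∑ k, Function.update w n t k * c k) (c n) t := by
  have := HasDerivAt.fun_sum (u := Finset.univ)
    fun k _ => (hasDerivAt_update_apply w n k t).mul_const (c k)
  refine this.congr_deriv ?_
  simp [Pi.single_apply]

theorem hasDerivAt_sigmaBar (hσw : 0 < sigmaBar P R w) (n : Fin N) :
    HasDerivAt (fun t => sigmaBar P R (Function.update w n t))
      ((∑ k, w k * cov[R n, R k; P]) / sigmaBar P R w) (w n) := by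
  have hS : ∑ k, ∑ l, w k * w l * cov[R k, R l; P] ≠ 0 := fun h0 => by
    simp [sigmaBar, h0] at hσw
  have h1 := HasDerivAt.fun_sum (u := Finset.univ) fun k _ =>
    HasDerivAt.fun_sum (u := Finset.univ) fun l _ =>
      ((hasDerivAt_update_apply w n k (w n)).fun_mul
        (hasDerivAt_update_apply w n l (w n))).mul_const (cov[R k, R l; P])
  have h2 := h1.sqrt (by simpa using hS)
  refine h2.congr_deriv ?_
  have e : ∑ k, ∑ l, (Pi.single (M := fun _ => ℝ) n 1 k * w l
      + w k * Pi.single (M := fun _ => ℝ) n 1 l) * cov[R k, R l; P]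
      = 2 * ∑ k, w k * cov[R n, R k; P] := by
    simp only [add_mul, Finset.sum_add_distrib, Pi.single_apply, ite_mul, mul_ite, one_mul,
      zero_mul, mul_one, mul_zero, Finset.sum_ite_eq', Finset.mem_univ, if_true]
    rw [Finset.sum_comm]
    simp only [Finset.sum_ite_eq', Finset.mem_univ, if_true]
    rw [two_mul]
    congr 1
    exact Finset.sum_congr rfl fun k _ => by rw [covariance_comm]
  simp only [Function.update_eq_self]
  rw [e, mul_div_mul_left _ _ two_ne_zero]
  rfl

theorem hasDerivAt_betaBar {σ β : Fin N → ℝ} (hσw : 0 < sigmaBar P R w) (n : Fin N) {dσ : ℝ}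
    (hd : HasDerivAt (fun t => sigmaBar P R (Function.update w n t)) dσ (w n)) :
    HasDerivAt (fun t => betaBar P R σ β (Function.update w n t))
      ((σ n * β n - betaBar P R σ β w * dσ) / sigmaBar P R w) (w n) := by
  have h1 := hasDerivAt_sum_update_mul w (fun k => σ k * β k) n (w n)
  simp only [← mul_assoc] at h1
  have h2 := h1.fun_div hd (by simpa using hσw.ne')
  refine h2.congr_deriv ?_
  simp only [Function.update_eq_self]
  rw [betaBar]
  field_simp

end PortfolioDeriv

end NTS

theorem proposition2 {Ω : Type*} [MeasurableSpace Ω] (P : Measure Ω) [IsProbabilityMeasure P]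
    {N : ℕ} (α θ η : ℝ) (hα : α ∈ Ioo (0 : ℝ) 2) (hθ : 0 < θ) (hη : η ∈ Ioo (0 : ℝ) 1)
    (β : Fin N → ℝ) (hβ : ∀ n, |β n| < NTS.betaBound α θ)
    (C : Matrix (Fin N) (Fin N) ℝ) (hC : C.PosSemidef) (hC1 : ∀ n, C n n = 1)
    (μ σ : Fin N → ℝ) (hσ : ∀ n, 0 ≤ σ n)
    (X : Ω → Fin N → ℝ) (hX : HasLaw X (NTS.stdNTSLaw α θ β C) P)
    (R : Fin N → Ω → ℝ) (hR : ∀ n ω, R n ω = μ n + σ n * X ω n)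
    (w : Fin N → ℝ) (hw : ∀ n, w n ∈ Icc (0 : ℝ) 1)
    (hσw : 0 < NTS.sigmaBar P R w)
    (hβw : |NTS.betaBar P R σ β w| < NTS.betaBound α θ) :
    -- the conditional Values-at-Risk of all portfolios are averages of integrable functions
    (∀ v : Fin N → ℝ, IntervalIntegrable
        (fun t => NTS.VaR (P.map (NTS.portfolioReturn R v)) t) volume 0 η) ∧
    -- the partial derivatives of `σ̄`, and the marginal contributions to VaR and to CVaR
    (∀ n : Fin N, ∀ dσ : ℝ,
      dσ = (∑ k, w k * cov[R n, R k; P]) / NTS.sigmaBar P R w →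
      HasDerivAt (fun t => NTS.sigmaBar P R (Function.update w n t)) dσ (w n) ∧
      HasDerivAt
        (fun t => NTS.VaR (P.map (NTS.portfolioReturn R (Function.update w n t))) η)
        (-μ n - NTS.stdNTSQuantile η α θ (NTS.betaBar P R σ β w) * dσ
          - (σ n * β n - NTS.betaBar P R σ β w * dσ)
            * deriv (fun b => NTS.stdNTSQuantile η α θ b) (NTS.betaBar P R σ β w))
        (w n) ∧
      HasDerivAt
        (fun t => NTS.CVaR (P.map (NTS.portfolioReturn R (Function.update w n t))) η)
        (-μ n + NTS.stdNTSCVaR η α θ (NTS.betaBar P R σ β w) * dσ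
          + (σ n * β n - NTS.betaBar P R σ β w * dσ)
            * deriv (fun b => NTS.stdNTSCVaR η α θ b) (NTS.betaBar P R σ β w))
        (w n)) ∧
    -- the derivatives with respect to the asymmetry parameter
    (∀ b : ℝ, |b| < NTS.betaBound α θ →
      DifferentiableAt ℝ (fun b' => NTS.stdNTSQuantile η α θ b') b ∧
      IntervalIntegrable (fun t => NTS.VaR (NTS.stdNTSLaw1 α θ b) t) volume 0 η ∧
      (∃ δ : ℝ, 0 < δ ∧ NTS.FiniteChFOnLine (NTS.stdNTSLaw1 α θ b) δ) ∧
      ∀ δ : ℝ, 0 < δ → NTS.FiniteChFOnLine (NTS.stdNTSLaw1 α θ b) δ →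
        IntegrableOn (fun u : ℝ => NTS.cvarIntegrand η α θ b δ u) (Ioi 0) ∧
        HasDerivAt (fun b' => NTS.stdNTSCVaR η α θ b')
          (-deriv (fun b' => NTS.stdNTSQuantile η α θ b') b
            - 1 / (Real.pi * η) * (∫ u in Ioi (0 : ℝ), NTS.cvarIntegrand η α θ b δ u).re) b ∧
        -- `ψ` is the logarithmic derivative of the characteristic function in `β`
        ((∀ᶠ b' in 𝓝 b, NTS.FiniteChFOnLine (NTS.stdNTSLaw1 α θ b') δ) →
          ∀ u : ℝ, HasDerivAt (fun b' => NTS.stdNTSChF (-u + Complex.I * δ) α θ b')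
            (NTS.stdNTSChF (-u + Complex.I * δ) α θ b
              * NTS.psi (-u + Complex.I * δ) α θ b) b)) := by
  have h := NTS.isTemperedStable_of_hasLaw hX
  have hquant := fun b (hb : |b| < NTS.betaBound α θ) =>
    NTS.differentiableAt_stdNTSQuantile h hα hθ hη hb
  have hcvar : ∀ b, |b| < NTS.betaBound α θ →
      DifferentiableAt ℝ (fun b' => NTS.stdNTSCVaR η α θ b') b := fun b hb => by
    obtain ⟨δ, hδ, hA⟩ := NTS.exists_ntsBaseReal_pos α θ b
    exact (NTS.hasDerivAt_stdNTSCVaR h hα hθ hη hδ hb hA.le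
      (hquant b hb).hasDerivAt).differentiableAt
  refine ⟨fun v => ?_, fun n dσ hdσ => ?_, fun b hb => ⟨hquant b hb, ?_, ?_, ?_⟩⟩
  · have := Measure.isProbabilityMeasure_map (NTS.aemeasurable_portfolioReturn hX hR v)
    exact NTS.intervalIntegrable_VaR (NTS.integrable_map_portfolioReturn hα hθ hX hR v) hη
  · have hd : HasDerivAt (fun t => NTS.sigmaBar P R (Function.update w n t)) dσ (w n) :=
      hdσ ▸ NTS.hasDerivAt_sigmaBar hσw n
    have hβd := NTS.hasDerivAt_betaBar (σ := σ) (β := β) hσw n hd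
    have hμd := NTS.hasDerivAt_sum_update_mul w μ n (w n)
    have hpos : ∀ᶠ t in 𝓝 (w n), 0 < NTS.sigmaBar P R (Function.update w n t) :=
      hd.continuousAt.eventually_const_lt (by simpa using hσw)
    have hcomp : ∀ {f : ℝ → ℝ}, DifferentiableAt ℝ f (NTS.betaBar P R σ β w) →
        HasDerivAt (fun t => NTS.sigmaBar P R (Function.update w n t)
          * f (NTS.betaBar P R σ β (Function.update w n t)))
          (f (NTS.betaBar P R σ β w) * dσ + (σ n * β n - NTS.betaBar P R σ β w * dσ)
            * deriv f (NTS.betaBar P R σ β w)) (w n) := fun {f} hf => by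
      have hf' : HasDerivAt f (deriv f (NTS.betaBar P R σ β w))
          (NTS.betaBar P R σ β (Function.update w n (w n))) := by
        rw [Function.update_eq_self]
        exact hf.hasDerivAt
      refine (hd.fun_mul (HasDerivAt.comp (h := fun t => NTS.betaBar P R σ β
        (Function.update w n t)) (w n) hf' hβd)).congr_deriv ?_
      simp only [Function.comp_apply, Function.update_eq_self]
      field_simp
    refine ⟨hd, ?_, ?_⟩
    · refine ((hμd.fun_neg.fun_sub (hcomp (hquant _ hβw))).congr_of_eventuallyEq ?_).congr_deriv
        (by ring)
      filter_upwards [hpos] with t ht using NTS.VaR_portfolioReturn hα hθ hη hX hR ht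
    · refine ((hμd.fun_neg.fun_add (hcomp (hcvar _ hβw))).congr_of_eventuallyEq ?_).congr_deriv
        (by ring)
      filter_upwards [hpos] with t ht using NTS.CVaR_portfolioReturn hα hθ hη hX hR ht
  · have := NTS.isProbabilityMeasure_stdNTSLaw1 h b
    exact NTS.intervalIntegrable_VaR (NTS.integrable_id_stdNTSLaw1 h hα hθ b) hη
  · obtain ⟨δ, hδ, hA⟩ := NTS.exists_ntsBaseReal_pos α θ b
    exact ⟨δ, hδ, NTS.finiteChFOnLine_iff.2
      (NTS.mem_integrableExpSet_of_ntsBaseReal_pos h hα hθ hb hA)⟩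
  · intro δ hδ hfin
    have hm := NTS.finiteChFOnLine_iff.1 hfin
    have hA := NTS.ntsBaseReal_nonneg h hα hθ hb hm
    have heq : EqOn (fun u => NTS.cvarIntegrand η α θ b δ u)
        (fun u => -NTS.fourierTermDeriv α θ 2 δ (NTS.stdNTSQuantile η α θ b, b) u
          (deriv (fun b' => NTS.stdNTSQuantile η α θ b') b, 1)) (Ioi 0) :=
      fun u hu => NTS.cvarIntegrand_eq h hα hθ hδ hb hm hu
    refine ⟨?_, ?_, fun hev u => NTS.hasDerivAt_stdNTSChF h hα hθ hδ hb hev u⟩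
    · refine IntegrableOn.congr_fun ?_ heq.symm measurableSet_Ioi
      exact ((NTS.integrableOn_fourierTermDeriv hα hθ 2 hδ
        (p := (NTS.stdNTSQuantile η α θ b, b)) (NTS.gammaSq_pos hα hθ hb)
          hA).apply_continuousLinearMap _).neg
    · refine (NTS.hasDerivAt_stdNTSCVaR h hα hθ hη hδ hb hA
        (hquant b hb).hasDerivAt).congr_deriv ?_
      rw [setIntegral_congr_fun measurableSet_Ioi heq, integral_neg, Complex.neg_re]
      have := hη.1.ne'
      field_simp
      ring
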